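/- Let $p$ be an odd prime, let $N$ be a number field and let $K,L$ be subfields of $N$ with $N=L\cdot K$ such that $N/K$ is cyclic of degree $p$, $[L:\mathbb{Q}]=p$, and $[N:L]$ is coprime to $p$. For a number field $E$ write $\mathcal{O}_E$ for its ring of integers, $U_E$ for the group of units, $\mathcal{I}_E$ and $\mathcal{P}_E$ for the groups of (nonzero) fractional and of principal fractional ideals, and $\mathrm{Cl}_E=\mathcal{I}_E/\mathcal{P}_E$. For an extension $E/F$ of degree $p$ regard $\mathcal{I}_F$ and $\mathcal{P}_F$ as subgroups of $\mathcal{I}_E$ by extension of ideals, and put $\mathcal{I}_{E/F}=\{\mathfrak{A}\in\mathcal{I}_E:\mathfrak{A}^p\in\mathcal{I}_F\}$ and $\mathcal{P}_{E/F}=\mathcal{I}_{E/F}\cap\mathcal{P}_E$. Let $\ker(N_{N/L})$ be the kernel of the map $\mathcal{I}_{N/K}/\mathcal{I}_K\to\mathcal{I}_{L/\mathbb{Q}}/\mathcal{I}_{\mathbb{Q}}$ induced by the relative norm of ideals, and let $T_{N/K}:\mathrm{Cl}_K\to\mathrm{Cl}_N$, $\mathfrak{a}\mathcal{P}_K\mapsto(\mathfrak{a}\mathcal{O}_N)\mathcal{P}_N$.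 Let $(r_1,r_2)$ be the signature of $K$, let $\theta=0$ if $K$ contains the $p$-th roots of unity and $\theta=1$ otherwise, and put $m=1+r_1+r_2-\theta$. (1) Fundamental equation. The index of $N_{N/K}(U_N)$ in $U_K$ is a power $p^U$ with $0\le U\le r_1+r_2-\theta$; the groups $$\mathcal{P}_{L/\mathbb{Q}}/\mathcal{P}_{\mathbb{Q}},\qquad \ker(N_{N/L})\cap\bigl((\mathcal{P}_{N/K}\mathcal{I}_K)/\mathcal{I}_K\bigr),\qquad \ker(T_{N/K})$$ are finite-dimensional $\mathbb{F}_p$-vector spaces; and their dimensions $A,R,C$ (in this order) satisfy $$U+1=A+R+C.$$ (2) Fundamental estimates. Assume moreover that $K$ is quadratic (in particular, this holds if $N/\mathbb{Q}$ is dihedral of degree $2p$ with quadratic subfield $K$ and $L$ a subfield of degree $p$). Among the prime ideals of $L$ that are totally ramified over $\mathbb{Q}$, let $s$ be the number of those that split in $N$ and $n$ the number of those that do not split in $N$. Let $\varrho_p=\dim_{\mathbb{F}_p}(\mathrm{Cl}_K/\mathrm{Cl}_K^p)$. Then $$0\le A\le\min(n+s,m),\qquad 0\le R\le\min(s,m),\qquad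 0\le C\le\min(\varrho_p,m).$$ Moreover, $m=2$ if $K$ is real quadratic, or if $p=3$ and $K=\mathbb{Q}(\sqrt{-3})$; and $m=1$ if $K$ is imaginary quadratic, except for $K=\mathbb{Q}(\sqrt{-3})$ when $p=3$. -/

import Mathlib

open scoped NumberField nonZeroDivisors

noncomputable section

namespace DPF

/-- The group `I_E` of (invertible, i.e. nonzero) fractional ideals of a number field `E`. -/
abbrev IdealGroup (E : Type*) [Field E] [NumberField E] : Type _ :=
  (FractionalIdeal (𝓞 E)⁰ E)ˣ

/-- The subgroup `P_E` of principal fractional ideals of `E`. -/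
def principal (E : Type*) [Field E] [NumberField E] : Subgroup (IdealGroup E) :=
  (toPrincipalIdeal (𝓞 E) E).range

section Extension

/-- The extension `𝔞 ↦ 𝔞 𝓞_E` of fractional ideals, by which `I_F` is embedded in `I_E`. -/
def extend (F E : Type*) [Field F] [NumberField F] [Field E] [NumberField E] [Algebra F E] :
    IdealGroup F →* IdealGroup E :=
  Units.map (FractionalIdeal.extendedHom (A := 𝓞 F) (K := F) E (𝓞 E)).toMonoidHom

/-- `I_F`, regarded as a subgroup of `I_E`. -/
def baseIdeals (F E : Type*) [Field F] [NumberField F] [Field E] [NumberField E] [Algebra F E] :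
    Subgroup (IdealGroup E) :=
  (extend F E).range

/-- `P_F`, regarded as a subgroup of `I_E`. -/
def basePrincipal (F E : Type*) [Field F] [NumberField F] [Field E] [NumberField E]
    [Algebra F E] : Subgroup (IdealGroup E) :=
  (principal F).map (extend F E)

/-- The group of ambiguous ideals `I_{E/F} = {𝔄 ∈ I_E ∣ 𝔄 ^ p ∈ I_F}` of an extension `E/F`
of degree `p`. -/
def ambiguous (p : ℕ) (F E : Type*) [Field F] [NumberField F] [Field E] [NumberField E]
    [Algebra F E] : Subgroup (IdealGroup E) :=
  (baseIdeals F E).comap (powMonoidHom p)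

/-- The group `P_{E/F} = I_{E/F} ∩ P_E` of ambiguous principal ideals. -/
def ambiguousPrincipal (p : ℕ) (F E : Type*) [Field F] [NumberField F] [Field E]
    [NumberField E] [Algebra F E] : Subgroup (IdealGroup E) :=
  ambiguous p F E ⊓ principal E

/-- The group `P_{E/F} / P_F` of differential principal factors of `E/F`. -/
abbrev PrincipalFactors (p : ℕ) (F E : Type*) [Field F] [NumberField F] [Field E]
    [NumberField E] [Algebra F E] : Type _ :=
  ambiguousPrincipal p F E ⧸ (basePrincipal F E).subgroupOf (ambiguousPrincipal p F E)

end Extension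

section RelNorm

/-- The relative norm of a fractional ideal, `N(𝔟 / d) = N(𝔟) / N(d)` for an integral ideal `𝔟`
and an integral element `d ≠ 0`. -/
def relNormFun (F E : Type*) [Field F] [NumberField F] [Field E] [NumberField E] [Algebra F E]
    (I : FractionalIdeal (𝓞 E)⁰ E) : FractionalIdeal (𝓞 F)⁰ F :=
  (Ideal.relNorm (𝓞 F) I.num : FractionalIdeal (𝓞 F)⁰ F) *
    ((Ideal.relNorm (𝓞 F) (Ideal.span {(I.den : 𝓞 E)}) : Ideal (𝓞 F)) :
      FractionalIdeal (𝓞 F)⁰ F)⁻¹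

theorem relNormFun_eq (F E : Type*) [Field F] [NumberField F] [Field E] [NumberField E]
    [Algebra F E] (I : FractionalIdeal (𝓞 E)⁰ E) (J D : Ideal (𝓞 E)) (hD : D ≠ ⊥)
    (h : (D : FractionalIdeal (𝓞 E)⁰ E) * I = (J : FractionalIdeal (𝓞 E)⁰ E)) :
    relNormFun F E I = (Ideal.relNorm (𝓞 F) J : FractionalIdeal (𝓞 F)⁰ F) *
      (Ideal.relNorm (𝓞 F) D : FractionalIdeal (𝓞 F)⁰ F)⁻¹ := by
  have hd : Ideal.span {(I.den : 𝓞 E)} ≠ ⊥ := by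
    simp
  have key : D * I.num = Ideal.span {(I.den : 𝓞 E)} * J := by
    have h2 := FractionalIdeal.den_mul_self_eq_num' (𝓞 E)⁰ E I
    rw [← FractionalIdeal.coeIdeal_span_singleton] at h2
    have : ((D * I.num : Ideal (𝓞 E)) : FractionalIdeal (𝓞 E)⁰ E) =
        ((Ideal.span {(I.den : 𝓞 E)} * J : Ideal (𝓞 E)) : FractionalIdeal (𝓞 E)⁰ E) := by
      rw [FractionalIdeal.coeIdeal_mul, FractionalIdeal.coeIdeal_mul, ← h, ← h2]
      ring
    exact FractionalIdeal.coeIdeal_injective this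
  have key2 := congrArg
    (fun X : Ideal (𝓞 E) => ((Ideal.relNorm (𝓞 F) X : Ideal (𝓞 F)) :
      FractionalIdeal (𝓞 F)⁰ F)) key
  simp only [map_mul, FractionalIdeal.coeIdeal_mul] at key2
  have n1 : ((Ideal.relNorm (𝓞 F) D : Ideal (𝓞 F)) : FractionalIdeal (𝓞 F)⁰ F) ≠ 0 := by
    rw [FractionalIdeal.coeIdeal_ne_zero]
    simpa using hD
  have n2 : ((Ideal.relNorm (𝓞 F) (Ideal.span {(I.den : 𝓞 E)}) : Ideal (𝓞 F)) :
      FractionalIdeal (𝓞 F)⁰ F) ≠ 0 := by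
    rw [FractionalIdeal.coeIdeal_ne_zero]
    simp
  rw [relNormFun, mul_inv_eq_iff_eq_mul₀ n2, mul_right_comm, eq_mul_inv_iff_mul_eq₀ n1,
    mul_comm _ (Ideal.relNorm (𝓞 F) D : FractionalIdeal (𝓞 F)⁰ F), key2, mul_comm]

/-- The relative norm on all fractional ideals, as a monoid homomorphism. -/
def relNormHom (F E : Type*) [Field F] [NumberField F] [Field E] [NumberField E] [Algebra F E] :
    FractionalIdeal (𝓞 E)⁰ E →* FractionalIdeal (𝓞 F)⁰ F where
  toFun := relNormFun F E
  map_one' := by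
    rw [relNormFun_eq F E 1 ⊤ ⊤ top_ne_bot (by simp)]
    simp
  map_mul' I J := by
    have hd (I : FractionalIdeal (𝓞 E)⁰ E) : Ideal.span {(I.den : 𝓞 E)} ≠ ⊥ := by
      simp
    have h2 (I : FractionalIdeal (𝓞 E)⁰ E) := FractionalIdeal.den_mul_self_eq_num' (𝓞 E)⁰ E I
    rw [relNormFun_eq F E (I * J) (I.num * J.num)
      (Ideal.span {(I.den : 𝓞 E)} * Ideal.span {(J.den : 𝓞 E)}) (mul_ne_zero (hd I) (hd J))]
    · simp only [relNormFun, map_mul, FractionalIdeal.coeIdeal_mul, mul_inv]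
      ring
    · rw [FractionalIdeal.coeIdeal_mul, FractionalIdeal.coeIdeal_mul, ← h2 I, ← h2 J,
        FractionalIdeal.coeIdeal_span_singleton, FractionalIdeal.coeIdeal_span_singleton]
      ring

/-- The relative norm `N_{E/F} : I_E → I_F`. -/
def relNorm (F E : Type*) [Field F] [NumberField F] [Field E] [NumberField E] [Algebra F E] :
    IdealGroup E →* IdealGroup F :=
  Units.map (relNormHom F E)

end RelNorm

/-- For `N/K` and `L/F` of degree `p`, the kernel of the map
`I_{N/K} / I_K → I_{L/F} / I_F` induced by the norm `N_{N/L}`, as a subgroup of `I_N / I_K`: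
the classes modulo `I_K` of those `𝔄 ∈ I_{N/K}` with `N_{N/L} 𝔄 ∈ I_F`. -/
def normKernel (p : ℕ) (F K L N : Type*) [Field F] [NumberField F] [Field K] [NumberField K]
    [Field L] [NumberField L] [Field N] [NumberField N] [Algebra F L] [Algebra K N]
    [Algebra L N] : Subgroup (IdealGroup N ⧸ baseIdeals K N) :=
  (ambiguous p K N ⊓ (baseIdeals F L).comap (relNorm L N)).map
    (QuotientGroup.mk' (baseIdeals K N))

/-- The group `ker(N_{N/L}) ∩ (P_{N/K} I_K / I_K)` of relative principal factors. -/
def relativeFactors (p : ℕ) (F K L N : Type*) [Field F] [NumberField F] [Field K]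
    [NumberField K] [Field L] [NumberField L] [Field N] [NumberField N] [Algebra F L]
    [Algebra K N] [Algebra L N] : Subgroup (IdealGroup N ⧸ baseIdeals K N) :=
  normKernel p F K L N ⊓
    (ambiguousPrincipal p K N ⊔ baseIdeals K N).map (QuotientGroup.mk' (baseIdeals K N))

/-- The kernel of the transfer of ideal classes `T_{N/K} : Cl_K → Cl_N`, `[𝔞] ↦ [𝔞 𝓞_N]`. -/
def capitulationKernel (K N : Type*) [Field K] [NumberField K] [Field N] [NumberField N]
    [Algebra K N] : Subgroup (ClassGroup (𝓞 K)) :=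
  (ClassGroup.extendedHom (𝓞 K) (𝓞 N)).ker

/-- The group of norms `N_{N/K}(U_N)`, as a subgroup of the unit group `U_K`. -/
def unitNorms (K N : Type*) [Field K] [NumberField K] [Field N] [NumberField N]
    [Algebra K N] : Subgroup (𝓞 K)ˣ :=
  (Units.map (RingOfIntegers.norm K : 𝓞 N →* 𝓞 K)).range

/-- The (multiplicative) group `G` is an `𝔽_p`-vector space of dimension `d`: it is elementary
abelian, isomorphic to `𝔽_p ^ d`. -/
def HasFpDim (p : ℕ) (G : Type*) [Group G] (d : ℕ) : Prop :=
  Nonempty (G ≃* Multiplicative (Fin d → ZMod p))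

/-- The `p`-class rank of `K`, the `𝔽_p`-dimension of `Cl_K / Cl_K ^ p`. -/
def classRank (p : ℕ) (K : Type*) [Field K] [NumberField K] : ℕ :=
  Module.finrank (ZMod p) (ModN (Additive (ClassGroup (𝓞 K))) p)

open Classical in
/-- `0` if `K` contains the `p`-th roots of unity, and `1` otherwise. -/
def theta (p : ℕ) (K : Type*) [Field K] : ℕ :=
  if ∃ ζ : K, IsPrimitiveRoot ζ p then 0 else 1

/-- The number `m = 1 + r₁ + r₂ - θ` (where `r₁ + r₂ ≥ 1`). -/
def cohMax (p : ℕ) (K : Type*) [Field K] [NumberField K] : ℕ :=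
  1 + NumberField.InfinitePlace.nrRealPlaces K + NumberField.InfinitePlace.nrComplexPlaces K
    - theta p K

/-- A nonzero prime ideal `𝔭` of `E` is totally ramified over `F` if `𝔩 𝓞_E = 𝔭 ^ [E : F]` for a
prime ideal `𝔩` of `F`. -/
def TotallyRamified (F : Type*) {E : Type*} [Field F] [NumberField F] [Field E] [NumberField E]
    [Algebra F E] (𝔭 : Ideal (𝓞 E)) : Prop :=
  𝔭.IsPrime ∧ 𝔭 ≠ ⊥ ∧ ∃ 𝔩 : Ideal (𝓞 F), 𝔩.IsPrime ∧
    𝔩.map (algebraMap (𝓞 F) (𝓞 E)) = 𝔭 ^ Module.finrank F E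

/-- A prime ideal `𝔭` of `L` splits in the quadratic extension `N`: `𝔭 𝓞_N = 𝔓 𝔓'` with two
different prime ideals of `N`. -/
def SplitsIn {L : Type*} (N : Type*) [Field L] [NumberField L] [Field N] [NumberField N]
    [Algebra L N] (𝔭 : Ideal (𝓞 L)) : Prop :=
  ∃ 𝔓 𝔓' : Ideal (𝓞 N), 𝔓.IsPrime ∧ 𝔓'.IsPrime ∧ 𝔓 ≠ 𝔓' ∧
    𝔭.map (algebraMap (𝓞 L) (𝓞 N)) = 𝔓 * 𝔓'

/-- The number `s` of prime ideals of `L`, totally ramified over `F`, that split in `N`. -/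
def splitCount (F L N : Type*) [Field F] [NumberField F] [Field L] [NumberField L] [Field N]
    [NumberField N] [Algebra F L] [Algebra L N] : ℕ :=
  {𝔭 : Ideal (𝓞 L) | TotallyRamified F 𝔭 ∧ SplitsIn N 𝔭}.ncard

/-- The number `n` of prime ideals of `L`, totally ramified over `F`, that do not split in
`N`. -/
def nonsplitCount (F L N : Type*) [Field F] [NumberField F] [Field L] [NumberField L] [Field N]
    [NumberField N] [Algebra F L] [Algebra L N] : ℕ :=
  {𝔭 : Ideal (𝓞 L) | TotallyRamified F 𝔭 ∧ ¬ SplitsIn N 𝔭}.ncard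

end DPF

end

/-! Everything is read off the finite group `P_{N/K} / P_K`, whose order is computed in two ways.

Arithmetic of units. Let `σ` generate the Galois group and put `D x = x / σ x`. A principal ideal
`(a)` is ambiguous exactly when `D a` is a unit, and by Hilbert 90 the image of `D` is the kernel of
the norm. Hence `D` identifies `P_{N/K} / P_K` with the units of norm one modulo `D(U_N)`, that is
with the Tate group `H⁻¹(U_N)`, while `U_K / N(U_N)` is `H⁰(U_N)`. The Herbrand quotient of a
finitely generated module depends only on ranks. Since `p` is odd, the infinite places of `K` split
completely in `N`, and the ranks give `|P_{N/K} / P_K| = p · p ^ U`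
(`relIndex_basePrincipal_eq_mul_index`).

Filtration by ideals. The part of `P_{N/K}` lying in `I_K`, modulo `P_K`, is the capitulation
kernel. What remains embeds in `I_N / I_K`, and the norm to `L` has the relative factors as kernel.
As `[N : L]` is prime to `p`, its image modulo `I_ℚ` is that of `P_{L/ℚ}`; as `ℚ` has class number
one, this is `P_{L/ℚ} / P_ℚ`. So the order is `p ^ (A + R + C)`
(`relIndex_basePrincipal_eq_card_mul`), and comparing exponents gives `U + 1 = A + R + C`.

Estimates. `U_K ^ p` consists of norms, so Dirichlet's unit theorem yields `U + 1 ≤ m`, which bounds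
each of `A`, `R`, `C`. For the ramification bounds, an ambiguous ideal comes from the base field
once its valuations at the totally ramified primes are divisible by `p`
(`mem_baseIdeals_of_dvd_val`); counting these valuations modulo `p` bounds `A` and, in the quadratic
case, `R`. Capitulating classes are killed by `p`, which bounds `C`. -/

noncomputable section

namespace DPF

/-! ### Herbrand quotients of finitely generated modules over a cyclic group of prime order -/

section FiniteGeneration

variable {M : Type*} [AddCommGroup M]

/-- Multiplicativity of the quotient `[M : f M] / |ker f|` under composition. Written with products,
it needs no finiteness: infinite indices and orders count as zero on both sides. -/
theorem index_range_comp_mul (f g : M →+ M) :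
    (f.comp g).range.index * (Nat.card f.ker * Nat.card g.ker) =
      Nat.card (f.comp g).ker * (f.range.index * g.range.index) := by
  have h1 : (f.comp g).range.index = (g.range ⊔ f.ker).index * f.range.index := by
    rw [AddMonoidHom.range_comp, AddSubgroup.index_map]
  have h2 : g.range.relIndex f.ker * (g.range ⊔ f.ker).index = g.range.index := by
    rw [← AddSubgroup.relIndex_sup_left, AddSubgroup.relIndex_mul_index le_sup_left]
  have h3 : Nat.card ↥(f.ker ⊓ g.range) * g.range.relIndex f.ker = Nat.card f.ker := by
    rw [← AddSubgroup.relIndex_bot_left, ← AddSubgroup.relIndex_bot_left,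
      ← AddSubgroup.relIndex_mul_relIndex ⊥ (f.ker ⊓ g.range) f.ker bot_le inf_le_left,
      AddSubgroup.inf_relIndex_left]
  have h4 : Nat.card g.ker * Nat.card ↥(f.ker ⊓ g.range) = Nat.card (f.comp g).ker := by
    have hle : g.ker ≤ (f.comp g).ker := fun x hx => by
      simp [AddMonoidHom.mem_ker, (AddMonoidHom.mem_ker).1 hx]
    have hmap : (f.comp g).ker.map g = f.ker ⊓ g.range := by
      rw [← AddMonoidHom.comap_ker, AddSubgroup.map_comap_eq, inf_comm]
    rw [← hmap, ← AddSubgroup.relIndex_ker, ← AddSubgroup.relIndex_bot_left,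
      AddSubgroup.relIndex_mul_relIndex _ _ _ bot_le hle, AddSubgroup.relIndex_bot_left]
  rw [h1, ← h2, ← h3, ← h4]
  ring

theorem exists_equiv_free_prod_finite [AddGroup.FG M] :
    ∃ (n : ℕ) (T : Type) (_ : AddCommGroup T) (_ : Finite T),
      Nonempty (M ≃+ (Fin n →₀ ℤ) × T) := by
  classical
  obtain ⟨n, ι, _, q, hq, e, ⟨f⟩⟩ := AddCommGroup.equiv_free_prod_directSum_zmod M
  have : ∀ i, NeZero (q i ^ e i) := fun i => ⟨pow_ne_zero _ (hq i).ne_zero⟩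
  exact ⟨n, _, _, Finite.of_equiv _ DFinsupp.equivFunOnFintype.symm, ⟨f⟩⟩

theorem finrank_int_eq_zero_of_finite [Finite M] : Module.finrank ℤ M = 0 := by
  rw [Module.finrank_eq_zero_iff]
  intro x
  exact ⟨addOrderOf x, by exact_mod_cast (addOrderOf_pos x).ne', by simp [addOrderOf_nsmul_eq_zero]⟩

theorem index_range_nsmul_prod (A B : Type*) [AddCommGroup A] [AddCommGroup B] (p : ℕ) :
    (nsmulAddMonoidHom (α := A × B) p).range.index =
      (nsmulAddMonoidHom (α := A) p).range.index * (nsmulAddMonoidHom (α := B) p).range.index := by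
  rw [← AddSubgroup.index_prod]
  congr 1
  ext ⟨a, b⟩
  simp [AddSubgroup.mem_prod, AddMonoidHom.mem_range, Prod.ext_iff]

/-- The free part contributes `p` to the power of the rank, and on the finite part kernel and
cokernel of multiplication by `p` have the same order. -/
theorem card_ker_mul_index_range_nsmul [AddGroup.FG M] {p : ℕ} (hp : p ≠ 0) :
    Finite (nsmulAddMonoidHom (α := M) p).ker ∧
      (nsmulAddMonoidHom (α := M) p).range.index =
        p ^ Module.finrank ℤ M * Nat.card (nsmulAddMonoidHom (α := M) p).ker := by
  obtain ⟨n, T, _, _, ⟨e⟩⟩ := exists_equiv_free_prod_finite (M := M)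
  have hr : Module.finrank ℤ M = n := by
    rw [e.toIntLinearEquiv.finrank_eq,
      ← Submodule.finrank_quotient_add_finrank (LinearMap.ker (LinearMap.fst ℤ (Fin n →₀ ℤ) T)),
      ((LinearMap.fst ℤ (Fin n →₀ ℤ) T).quotKerEquivOfSurjective
        LinearMap.fst_surjective).finrank_eq]
    have : Finite (LinearMap.ker (LinearMap.fst ℤ (Fin n →₀ ℤ) T)) := by
      refine Finite.of_injective (fun x => x.1.2) ?_
      rintro ⟨⟨a, b⟩, h⟩ ⟨⟨a', b'⟩, h'⟩ h2
      simp only [LinearMap.mem_ker, LinearMap.fst_apply] at h h'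
      simp_all
    rw [finrank_int_eq_zero_of_finite (M := LinearMap.ker (LinearMap.fst ℤ (Fin n →₀ ℤ) T))]
    simp
  have hker : Nat.card (nsmulAddMonoidHom (α := M) p).ker =
      Nat.card (nsmulAddMonoidHom (α := T) p).ker ∧
      Finite (nsmulAddMonoidHom (α := M) p).ker := by
    let g : (nsmulAddMonoidHom (α := M) p).ker ≃ (nsmulAddMonoidHom (α := T) p).ker :=
      { toFun := fun x => ⟨(e x.1).2, by
          have := congrArg Prod.snd (congrArg e ((AddMonoidHom.mem_ker).1 x.2))
          simpa [AddMonoidHom.mem_ker] using this⟩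
        invFun := fun t => ⟨e.symm (0, t.1), by
          have := (AddMonoidHom.mem_ker).1 t.2
          simp only [nsmulAddMonoidHom_apply] at this
          simp only [AddMonoidHom.mem_ker, nsmulAddMonoidHom_apply]
          rw [← map_nsmul]
          simp [this]⟩
        left_inv := fun x => by
          have h := congrArg Prod.fst (congrArg e ((AddMonoidHom.mem_ker).1 x.2))
          simp only [nsmulAddMonoidHom_apply, map_nsmul, Prod.smul_fst, map_zero, Prod.fst_zero,
            smul_eq_zero, hp, false_or] at h
          ext
          rw [e.symm_apply_eq]
          exact Prod.ext h.symm rfl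
        right_inv := fun t => by simp }
    exact ⟨Nat.card_congr g, Finite.of_equiv _ g.symm⟩
  refine ⟨hker.2, ?_⟩
  have hT : (nsmulAddMonoidHom (α := T) p).range.index =
      Nat.card (nsmulAddMonoidHom (α := T) p).ker := by
    have h1 := AddSubgroup.card_mul_index (nsmulAddMonoidHom (α := T) p).range
    have h2 := AddSubgroup.card_mul_index (nsmulAddMonoidHom (α := T) p).ker
    rw [AddSubgroup.index_ker, mul_comm] at h2
    exact Nat.eq_of_mul_eq_mul_left Nat.card_pos (h1.trans h2.symm)
  have hF : (nsmulAddMonoidHom (α := Fin n →₀ ℤ) p).range.index = p ^ n := by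
    have : NeZero p := ⟨hp⟩
    have h := ModN.natCard_eq (G := Fin n →₀ ℤ) (n := p)
    rw [Module.finrank_finsupp_self, Fintype.card_fin] at h
    rw [← h]
    refine Nat.card_congr (QuotientAddGroup.quotientAddEquivOfEq ?_).toEquiv
    ext x
    simp [AddMonoidHom.mem_range]
  rw [hr, hker.1, ← hT, ← hF, ← index_range_nsmul_prod,
    ← AddSubgroup.index_map_equiv _ e]
  congr 1
  ext x
  simp only [AddSubgroup.mem_map, AddMonoidHom.mem_range, nsmulAddMonoidHom_apply]
  constructor
  · rintro ⟨_, ⟨y, rfl⟩, rfl⟩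
    exact ⟨e y, by simp⟩
  · rintro ⟨y, rfl⟩
    exact ⟨_, ⟨e.symm y, rfl⟩, by simp⟩

open Polynomial in
-- The right side vanishes at a primitive `p`-th root of unity `ζ`, because `∏ (1 - ζ ^ k) = p` over
-- `0 < k < p`.
theorem cyclotomic_dvd_prod_one_sub_X_pow {p : ℕ} (hp : p.Prime) :
    cyclotomic p ℤ ∣ ∏ k ∈ Finset.range (p - 1), (1 - X ^ (k + 1)) - (p : ℤ[X]) := by
  have hζ := Complex.isPrimitiveRoot_exp p hp.ne_zero
  rw [cyclotomic_eq_minpoly hζ hp.pos]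
  refine minpoly.isIntegrallyClosed_dvd (hζ.isIntegral hp.pos) ?_
  have h : IsPrimitiveRoot (Complex.exp (2 * Real.pi * Complex.I / p)) (p - 1 + 1) := by
    rwa [Nat.sub_add_cancel hp.one_le]
  have h2 := h.prod_one_sub_pow_eq_order
  simp only [map_sub, map_prod, map_one, map_pow, aeval_X, map_natCast, h2]
  rw [Nat.cast_sub hp.one_le]
  simp

/-- Once the trace vanishes, `ℤ[σ]` is an image of `ℤ[ζ]`, so the identity can be evaluated at `σ`.
A list product is used because the ambient endomorphism ring is not commutative. -/
theorem prod_one_sub_pow_eq_natCast {R : Type*} [Ring R] {p : ℕ} (hp : p.Prime) {σ : R}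
    (hT : ∑ i ∈ Finset.range p, σ ^ i = 0) :
    ((List.range (p - 1)).map fun k => 1 - σ ^ (k + 1)).prod = (p : R) := by
  obtain ⟨g, hg⟩ := cyclotomic_dvd_prod_one_sub_X_pow hp
  have h1 := congrArg (Polynomial.aeval σ) hg
  have : Fact p.Prime := ⟨hp⟩
  have h0 : Polynomial.aeval σ (Polynomial.cyclotomic p ℤ) = 0 := by
    simp [Polynomial.cyclotomic_prime, hT]
  rw [map_mul, h0, zero_mul, map_sub, map_natCast, sub_eq_zero, Finset.prod_eq_multiset_prod,
    Finset.range_val, ← Multiset.coe_range, Multiset.map_coe, Multiset.prod_coe, map_list_prod,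
    List.map_map] at h1
  rw [← h1]
  simp [Function.comp_def]

/-- If `σ` has order dividing `p` and `p ∤ i`, then `1 - σ` and `1 - σ ^ i` differ by commuting
factors in both directions. -/
theorem exists_one_sub_pow_eq_mul {R : Type*} [Ring R] {p : ℕ} (hp : p.Prime) {σ : R}
    (hσ : σ ^ p = 1) {i : ℕ} (hi : ¬ p ∣ i) :
    ∃ a b : R, 1 - σ ^ i = (1 - σ) * a ∧ 1 - σ ^ i = a * (1 - σ) ∧
      1 - σ = (1 - σ ^ i) * b ∧ 1 - σ = b * (1 - σ ^ i) := by
  obtain ⟨j, hj⟩ : ∃ j, i * j ≡ 1 [MOD p] :=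
    Nat.exists_mul_mod_eq_one_of_coprime ((Nat.Prime.coprime_iff_not_dvd hp).2 hi).symm hp.one_lt
      |>.imp fun j h => by rw [Nat.ModEq, h.2, Nat.mod_eq_of_lt hp.one_lt]
  have hσ1 : (σ ^ i) ^ j = σ := by
    rw [← pow_mul]
    conv_rhs => rw [← pow_one σ]
    exact pow_eq_pow_of_modEq hj hσ
  refine ⟨∑ k ∈ Finset.range i, σ ^ k, ∑ k ∈ Finset.range j, (σ ^ i) ^ k,
    (mul_neg_geom_sum σ i).symm, (geom_sum_mul_neg σ i).symm, ?_, ?_⟩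
  · rw [mul_neg_geom_sum, hσ1]
  · rw [geom_sum_mul_neg, hσ1]

theorem mem_ker_end {f : AddMonoid.End M} {x : M} : x ∈ AddMonoidHom.ker f ↔ f x = 0 := Iff.rfl

theorem mem_range_end {f : AddMonoid.End M} {x : M} :
    x ∈ AddMonoidHom.range f ↔ ∃ y, f y = x := Iff.rfl

theorem mem_map_end {f : AddMonoid.End M} {H : AddSubgroup M} {x : M} :
    x ∈ AddSubgroup.map f H ↔ ∃ y ∈ H, f y = x := Iff.rfl

theorem relIndex_map_range (f : M →+ M) (H : AddSubgroup M) :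
    (H.map f).relIndex f.range = (H ⊔ f.ker).index := by
  rw [AddMonoidHom.range_eq_map, AddSubgroup.relIndex_map_map, top_sup_eq,
    AddSubgroup.relIndex_top_right]

theorem fg_addSubgroup [AddGroup.FG M] (H : AddSubgroup M) : AddGroup.FG H := by
  have : Module.Finite ℤ M := Module.Finite.iff_addGroup_fg.2 inferInstance
  exact Module.Finite.iff_addGroup_fg.1
    (inferInstanceAs (Module.Finite ℤ (AddSubgroup.toIntSubmodule H)))

theorem finrank_addSubgroup_of_relIndex_ne_zero [AddGroup.FG M] {H K : AddSubgroup M} (h : H ≤ K)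
    (h0 : H.relIndex K ≠ 0) : Module.finrank ℤ H = Module.finrank ℤ K := by
  have : Module.Finite ℤ K := Module.Finite.iff_addGroup_fg.2 (fg_addSubgroup K)
  have h1 := Submodule.finrank_quotient_add_finrank (AddSubgroup.toIntSubmodule (H.addSubgroupOf K))
  have h2 : Finite (K ⧸ AddSubgroup.toIntSubmodule (H.addSubgroupOf K)) :=
    Nat.finite_of_card_ne_zero h0
  rw [finrank_int_eq_zero_of_finite, zero_add] at h1
  rw [← h1]
  exact (AddSubgroup.addSubgroupOfEquivOfLe h).symm.toIntLinearEquiv.finrank_eq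

theorem finrank_ker_add_finrank_range [AddGroup.FG M] (f : M →+ M) :
    Module.finrank ℤ f.ker + Module.finrank ℤ f.range = Module.finrank ℤ M := by
  have : Module.Finite ℤ M := Module.Finite.iff_addGroup_fg.2 inferInstance
  have h := Submodule.finrank_quotient_add_finrank (LinearMap.ker f.toIntLinearMap)
  rw [f.toIntLinearMap.quotKerEquivRange.finrank_eq, add_comm] at h
  exact h

theorem end_mul_apply (f g : AddMonoid.End M) (x : M) : (f * g) x = f (g x) := rfl

theorem finite_ker_comp (f g : M →+ M) (hf : Finite f.ker) (hg : Finite g.ker) :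
    Finite (f.comp g).ker := by
  have h : g.ker ≤ (f.comp g).ker := fun x hx => by
    simp [AddMonoidHom.mem_ker, (AddMonoidHom.mem_ker).1 hx]
  have : Finite ((f.comp g).ker.map g) := by
    refine Finite.of_injective _ (AddSubgroup.inclusion_injective (K := f.ker) ?_)
    rw [← AddMonoidHom.comap_ker]
    exact AddSubgroup.map_comap_le _ _
  refine Nat.finite_of_card_ne_zero ?_
  rw [← AddSubgroup.relIndex_bot_left, ← AddSubgroup.relIndex_mul_relIndex ⊥ g.ker _ bot_le h,
    AddSubgroup.relIndex_ker, AddSubgroup.relIndex_bot_left]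
  exact mul_ne_zero Nat.card_pos.ne' Nat.card_pos.ne'

theorem ker_range_one_sub_pow {p : ℕ} (hp : p.Prime) {σ : AddMonoid.End M}
    (hσ : σ ^ p = 1) {i : ℕ} (hi : ¬ p ∣ i) :
    AddMonoidHom.ker (1 - σ ^ i : AddMonoid.End M) = AddMonoidHom.ker (1 - σ : AddMonoid.End M) ∧
      AddMonoidHom.range (1 - σ ^ i : AddMonoid.End M) =
        AddMonoidHom.range (1 - σ : AddMonoid.End M) := by
  obtain ⟨a, b, h1, h2, h3, h4⟩ := exists_one_sub_pow_eq_mul hp hσ hi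
  constructor
  · apply le_antisymm <;> intro x hx <;> rw [mem_ker_end] at *
    · rw [h4, end_mul_apply, hx, map_zero]
    · rw [h2, end_mul_apply, hx, map_zero]
  · apply le_antisymm <;> rintro _ ⟨x, rfl⟩
    · exact ⟨a x, (DFunLike.congr_fun (F := AddMonoid.End M) h1 x).symm⟩
    · exact ⟨b x, (DFunLike.congr_fun (F := AddMonoid.End M) h3 x).symm⟩

/-- Here `M` is a `ℤ[ζ]`-module and `p` is a product of `p - 1` factors `1 - σ ^ k`, each with the
kernel and range of `1 - σ`. Multiplicativity of index over kernel order turns the known value for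
multiplication by `p` into the `(p - 1)`-st power of the value for `1 - σ`. -/
theorem index_range_one_sub_pow_eq [AddGroup.FG M] {p : ℕ} (hp : p.Prime) {σ : AddMonoid.End M}
    (hσ : σ ^ p = 1) (hT : ∑ i ∈ Finset.range p, σ ^ i = 0)
    (hfin : Finite (AddMonoidHom.ker (1 - σ : AddMonoid.End M))) :
    (AddMonoidHom.range (1 - σ : AddMonoid.End M)).index ^ (p - 1) =
      p ^ Module.finrank ℤ M * Nat.card (AddMonoidHom.ker (1 - σ : AddMonoid.End M)) ^ (p - 1) := by
  set D : AddMonoid.End M := 1 - σ with hD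
  -- Induction over partial products. The nonvanishing of the kernel order is carried along so that
  -- it can be cancelled at each step.
  have key : ∀ n, n ≤ p - 1 → ∀ P : AddMonoid.End M,
      P = ((List.range n).map fun k => 1 - σ ^ (k + 1)).prod →
      Nat.card P.ker ≠ 0 ∧
        P.range.index * Nat.card D.ker ^ n = Nat.card P.ker * D.range.index ^ n := by
    intro n
    induction n with
    | zero =>
      rintro - P rfl
      have h1 : AddMonoidHom.ker (1 : AddMonoid.End M) = ⊥ := by
        ext x; exact Iff.rfl
      have h2 : AddMonoidHom.range (1 : AddMonoid.End M) = ⊤ := by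
        ext x; exact ⟨fun _ => trivial, fun _ => ⟨x, rfl⟩⟩
      simp only [List.range_zero, List.map_nil, List.prod_nil]
      rw [h1, h2]
      simp
    | succ n ih =>
      rintro hn P rfl
      obtain ⟨hQ0, hQ⟩ := ih (by omega) _ rfl
      set Q : AddMonoid.End M := ((List.range n).map fun k => 1 - σ ^ (k + 1)).prod with hQd
      obtain ⟨hk, hr⟩ := ker_range_one_sub_pow (M := M) hp hσ (i := n + 1)
        (Nat.not_dvd_of_pos_of_lt (by omega) (by omega))
      have hc := index_range_comp_mul (M := M) Q (1 - σ ^ (n + 1) : AddMonoid.End M)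
      rw [hk, hr] at hc
      rw [List.range_succ, List.map_append, List.prod_append, List.map_singleton,
        List.prod_singleton, ← hQd]
      change (AddMonoidHom.comp Q (1 - σ ^ (n + 1) : AddMonoid.End M)).range.index *
        (Nat.card Q.ker * Nat.card D.ker) = Nat.card (AddMonoidHom.comp Q _).ker *
          (Q.range.index * D.range.index) at hc
      change Nat.card (AddMonoidHom.comp Q (1 - σ ^ (n + 1) : AddMonoid.End M)).ker ≠ 0 ∧
        (AddMonoidHom.comp Q (1 - σ ^ (n + 1) : AddMonoid.End M)).range.index * _ =
          Nat.card (AddMonoidHom.comp Q (1 - σ ^ (n + 1) : AddMonoid.End M)).ker * _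
      constructor
      · have := finite_ker_comp (M := M) Q (1 - σ ^ (n + 1) : AddMonoid.End M)
          (Nat.finite_of_card_ne_zero hQ0) (by rwa [hk])
        exact Nat.card_pos.ne'
      · refine Nat.eq_of_mul_eq_mul_left (Nat.pos_of_ne_zero hQ0) ?_
        calc _ = ((AddMonoidHom.comp Q (1 - σ ^ (n + 1) : AddMonoid.End M)).range.index *
              (Nat.card Q.ker * Nat.card D.ker)) * Nat.card D.ker ^ n := by ring
          _ = Nat.card (AddMonoidHom.comp Q (1 - σ ^ (n + 1) : AddMonoid.End M)).ker *
              (Q.range.index * Nat.card D.ker ^ n) * D.range.index := by rw [hc]; ring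
          _ = _ := by rw [hQ]; ring
  have hpe : (p : AddMonoid.End M) = nsmulAddMonoidHom (α := M) p := by
    ext x; exact AddMonoid.End.natCast_apply p x
  obtain ⟨h0, h1⟩ := key (p - 1) le_rfl _ (prod_one_sub_pow_eq_natCast hp hT).symm
  obtain ⟨h2, h3⟩ := card_ker_mul_index_range_nsmul (M := M) hp.ne_zero
  rw [hpe] at h0 h1
  rw [h3] at h1
  refine Nat.eq_of_mul_eq_mul_left (Nat.pos_of_ne_zero h0) ?_
  rw [← h1]
  ring

theorem card_addSubgroupOf (H K : AddSubgroup M) :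
    Nat.card (H.addSubgroupOf K) = Nat.card ↥(H ⊓ K) := by
  rw [← AddSubgroup.addSubgroupOf_map_subtype]
  exact Nat.card_congr ((H.addSubgroupOf K).equivMapOfInjective _ K.subtype_injective).toEquiv

theorem one_sub_mul_sum_pow {R : Type*} [Ring R] {p : ℕ} {σ : R} (hσ : σ ^ p = 1) :
    (1 - σ) * ∑ i ∈ Finset.range p, σ ^ i = 0 ∧ (∑ i ∈ Finset.range p, σ ^ i) * (1 - σ) = 0 := by
  rw [mul_neg_geom_sum, geom_sum_mul_neg, hσ, sub_self]
  simp

theorem sum_pow_apply_of_mem_ker {p : ℕ} {σ : AddMonoid.End M} {x : M}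
    (hx : x ∈ AddMonoidHom.ker (1 - σ : AddMonoid.End M)) :
    (∑ i ∈ Finset.range p, σ ^ i : AddMonoid.End M) x = p • x := by
  have h1 : σ x = x := (sub_eq_zero.1 (mem_ker_end.1 hx)).symm
  have h2 : ∀ i, (σ ^ i : AddMonoid.End M) x = x := by
    intro i
    induction i with
    | zero => rfl
    | succ n ih => rw [pow_succ, end_mul_apply, h1, ih]
  have h3 : (∑ i ∈ Finset.range p, σ ^ i : AddMonoid.End M) x =
      ∑ i ∈ Finset.range p, (σ ^ i : AddMonoid.End M) x := AddMonoidHom.finsetSum_apply _ _ _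
  rw [h3]
  simp [h2]

/-- The trace-zero case applied to the kernel of `T`, which `σ` preserves because it commutes with
`T`. -/
theorem relIndex_map_ker_sum_pow [AddGroup.FG M] {p : ℕ} (hp : p.Prime) {σ : AddMonoid.End M}
    (hσ : σ ^ p = 1) {D T : AddMonoid.End M} (hD : D = 1 - σ)
    (hT : T = ∑ i ∈ Finset.range p, σ ^ i) (hfin : Finite ↥(D.ker ⊓ T.ker)) :
    ((T.ker.map D).relIndex T.ker) ^ (p - 1) =
      p ^ Module.finrank ℤ T.ker * Nat.card ↥(D.ker ⊓ T.ker) ^ (p - 1) := by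
  have hcomm : ∀ i, Commute σ (σ ^ i) := fun i => Commute.pow_right rfl i
  have hTσ : T * σ = σ * T := by
    rw [hT, Finset.sum_mul, Finset.mul_sum]
    exact Finset.sum_congr rfl fun i _ => (hcomm i).symm.eq
  have hmaps : ∀ x : T.ker, σ (x : M) ∈ T.ker := fun x => by
    have : T (σ (x : M)) = σ (T (x : M)) := DFunLike.congr_fun (F := AddMonoid.End M) hTσ (x : M)
    rw [mem_ker_end, this, mem_ker_end.1 x.2, map_zero]
  let σ₀ : AddMonoid.End T.ker :=
    AddMonoidHom.codRestrict (AddMonoidHom.comp σ T.ker.subtype) T.ker hmaps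
  have hσ₀ : ∀ i (x : T.ker), ((σ₀ ^ i : AddMonoid.End T.ker) x : M) =
      (σ ^ i : AddMonoid.End M) x := by
    intro i
    induction i with
    | zero => intro x; rfl
    | succ n ih =>
      intro x
      rw [pow_succ, pow_succ, end_mul_apply, end_mul_apply, ih]
      rfl
  have h1 : σ₀ ^ p = 1 := by
    ext x
    rw [hσ₀, hσ]
    rfl
  have h2 : ∑ i ∈ Finset.range p, σ₀ ^ i = 0 := by
    ext x
    have h3 : (∑ i ∈ Finset.range p, σ₀ ^ i : AddMonoid.End T.ker) x =
      ∑ i ∈ Finset.range p, (σ₀ ^ i : AddMonoid.End T.ker) x := AddMonoidHom.finsetSum_apply _ _ _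
    have h4 : (∑ i ∈ Finset.range p, σ ^ i : AddMonoid.End M) x =
      ∑ i ∈ Finset.range p, (σ ^ i : AddMonoid.End M) x := AddMonoidHom.finsetSum_apply _ _ _
    rw [h3, AddSubgroup.val_finsetSum]
    simp only [hσ₀]
    rw [← h4, ← hT]
    exact mem_ker_end.1 x.2
  have hk : AddMonoidHom.ker (1 - σ₀ : AddMonoid.End T.ker) =
      AddSubgroup.addSubgroupOf D.ker T.ker := by
    ext x
    rw [AddSubgroup.mem_addSubgroupOf, mem_ker_end, mem_ker_end, hD, Subtype.ext_iff]
    exact Iff.rfl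
  have hr : AddMonoidHom.range (1 - σ₀ : AddMonoid.End T.ker) =
      (T.ker.map D).addSubgroupOf T.ker := by
    ext x
    rw [AddSubgroup.mem_addSubgroupOf, mem_range_end, mem_map_end, hD]
    constructor
    · rintro ⟨y, rfl⟩
      exact ⟨y, y.2, rfl⟩
    · rintro ⟨y, hy, h⟩
      exact ⟨⟨y, hy⟩, Subtype.ext h⟩
  have := fg_addSubgroup T.ker
  have hc : Nat.card (AddMonoidHom.ker (1 - σ₀ : AddMonoid.End T.ker)) =
      Nat.card ↥(D.ker ⊓ T.ker) := by
    rw [hk, card_addSubgroupOf]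
  have key := index_range_one_sub_pow_eq hp h1 h2
    (Nat.finite_of_card_ne_zero (by rw [hc]; exact Nat.card_pos.ne'))
  rw [hc, hr] at key
  exact key

/-- The Herbrand quotient of a finitely generated module over a cyclic group of prime order `p` is
determined by the ranks of the module and of its submodule of invariants. -/
theorem herbrand_quotient_eq [AddGroup.FG M] {p : ℕ} (hp : p.Prime) {σ : AddMonoid.End M}
    (hσ : σ ^ p = 1) {D T : AddMonoid.End M} (hD : D = 1 - σ)
    (hT : T = ∑ i ∈ Finset.range p, σ ^ i) :
    Module.finrank ℤ M = Module.finrank ℤ D.ker + Module.finrank ℤ T.ker ∧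
      T.range.relIndex D.ker ≠ 0 ∧
      (T.range.relIndex D.ker) ^ (p - 1) * p ^ Module.finrank ℤ T.ker =
        (D.range.relIndex T.ker) ^ (p - 1) * p ^ ((p - 1) * Module.finrank ℤ D.ker) := by
  have hTD : ∀ x ∈ D.ker, T x = p • x := fun x hx => by
    rw [hT]; exact sum_pow_apply_of_mem_ker (hD ▸ hx)
  obtain ⟨hDT0, hTD0⟩ := one_sub_mul_sum_pow hσ
  rw [← hD, ← hT] at hDT0 hTD0
  have hrT : T.range ≤ D.ker := by
    rintro _ ⟨x, rfl⟩
    exact DFunLike.congr_fun (F := AddMonoid.End M) hDT0 x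
  have hrD : D.range ≤ T.ker := by
    rintro _ ⟨x, rfl⟩
    exact DFunLike.congr_fun (F := AddMonoid.End M) hTD0 x
  have := fg_addSubgroup D.ker
  obtain ⟨hfin, hidx⟩ := card_ker_mul_index_range_nsmul (M := D.ker) hp.ne_zero
  have hk : (nsmulAddMonoidHom (α := D.ker) p).ker = T.ker.addSubgroupOf D.ker := by
    ext x
    rw [AddSubgroup.mem_addSubgroupOf, AddMonoidHom.mem_ker, mem_ker_end, hTD x x.2,
      Subtype.ext_iff]
    exact Iff.rfl
  have hr : (nsmulAddMonoidHom (α := D.ker) p).range = (D.ker.map T).addSubgroupOf D.ker := by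
    ext x
    rw [AddSubgroup.mem_addSubgroupOf, AddMonoidHom.mem_range, mem_map_end]
    constructor
    · rintro ⟨y, rfl⟩
      exact ⟨y, y.2, hTD y y.2⟩
    · rintro ⟨y, hy, h⟩
      exact ⟨⟨y, hy⟩, Subtype.ext ((hTD y hy).symm.trans h)⟩
  have hc : Nat.card (nsmulAddMonoidHom (α := D.ker) p).ker = Nat.card ↥(D.ker ⊓ T.ker) := by
    rw [hk, card_addSubgroupOf, inf_comm]
  have hfin' : Finite ↥(D.ker ⊓ T.ker) :=
    Nat.finite_of_card_ne_zero (by rw [← hc]; exact Nat.card_pos.ne')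
  have hY := relIndex_map_ker_sum_pow hp hσ hD hT hfin'
  rw [hc, hr] at hidx
  change (D.ker.map T).relIndex D.ker = _ at hidx
  have hpos : Nat.card ↥(D.ker ⊓ T.ker) ≠ 0 := Nat.card_pos.ne'
  have hX : (D.ker.map T).relIndex T.range * T.range.relIndex D.ker =
      (D.ker.map T).relIndex D.ker :=
    AddSubgroup.relIndex_mul_relIndex _ _ _ (AddSubgroup.map_le_range _ _) hrT
  have hX' : (T.ker.map D).relIndex D.range * D.range.relIndex T.ker =
      (T.ker.map D).relIndex T.ker :=
    AddSubgroup.relIndex_mul_relIndex _ _ _ (AddSubgroup.map_le_range _ _) hrD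
  -- On `ker D` the trace is multiplication by `p`, so `[ker D : T(ker D)]` is known; `[ker T :
  -- D(ker T)]` is known from the trace-zero case. Each exceeds the wanted Tate index by the same
  -- factor `[M : ker D + ker T]`, which cancels.
  have hi : (D.ker.map T).relIndex T.range = (D.ker ⊔ T.ker).index := 
    relIndex_map_range (M := M) T D.ker
  have hi' : (T.ker.map D).relIndex D.range = (D.ker ⊔ T.ker).index := by
    rw [sup_comm]
    exact relIndex_map_range (M := M) D T.ker
  rw [hi, hidx] at hX
  rw [hi'] at hX'
  have hne : (D.ker ⊔ T.ker).index * T.range.relIndex D.ker ≠ 0 := by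
    rw [hX]
    exact mul_ne_zero (pow_ne_zero _ hp.ne_zero) hpos
  refine ⟨?_, right_ne_zero_of_mul hne, ?_⟩
  · rw [← finrank_addSubgroup_of_relIndex_ne_zero hrT (right_ne_zero_of_mul hne), add_comm]
    exact (finrank_ker_add_finrank_range (M := M) T).symm
  · rw [← hX', mul_pow] at hY
    have h0 : 0 < (D.ker ⊔ T.ker).index ^ (p - 1) * Nat.card ↥(D.ker ⊓ T.ker) ^ (p - 1) :=
      Nat.pos_of_ne_zero
        (mul_ne_zero (pow_ne_zero _ (left_ne_zero_of_mul hne)) (pow_ne_zero _ hpos))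
    refine Nat.eq_of_mul_eq_mul_left h0 ?_
    calc _ = ((D.ker ⊔ T.ker).index * T.range.relIndex D.ker) ^ (p - 1) *
          (p ^ Module.finrank ℤ T.ker * Nat.card ↥(D.ker ⊓ T.ker) ^ (p - 1)) := by
            rw [mul_pow]; ring
      _ = _ := by rw [hX, ← hY, mul_pow, ← pow_mul, mul_comm (p - 1)]; ring

end FiniteGeneration

/-! ### Fractional ideals: extension, norm and principal ideals -/

section IdealGroups

variable {F E : Type*} [Field F] [NumberField F] [Field E] [NumberField E] [Algebra F E]

open IsDedekindDomain

/-- The valuation of fractional ideals at a prime `v`. -/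
def val (v : HeightOneSpectrum (𝓞 E)) : IdealGroup E →* Multiplicative ℤ where
  toFun A := Multiplicative.ofAdd (FractionalIdeal.count E v (A : FractionalIdeal (𝓞 E)⁰ E))
  map_one' := by rw [Units.val_one, FractionalIdeal.count_one]; rfl
  map_mul' A B := by
    rw [Units.val_mul, FractionalIdeal.count_mul E v A.ne_zero B.ne_zero]; rfl

/-- The element of `I_E` given by a nonzero integral ideal. -/
def ofIdeal (I : Ideal (𝓞 E)) (hI : I ≠ ⊥) : IdealGroup E :=
  Units.mk0 (I : FractionalIdeal (𝓞 E)⁰ E) (FractionalIdeal.coeIdeal_ne_zero.2 hI)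

theorem val_injective {A B : IdealGroup E} (h : ∀ v, val v A = val v B) : A = B := by
  refine Units.ext ?_
  rw [← FractionalIdeal.finprod_heightOneSpectrum_factorization' E A.ne_zero,
    ← FractionalIdeal.finprod_heightOneSpectrum_factorization' E B.ne_zero]
  exact finprod_congr fun v => by
    rw [show FractionalIdeal.count E v A.1 = FractionalIdeal.count E v B.1 from h v]

/-- The ideal group is torsion-free because valuations take values in `ℤ`. -/
theorem pow_left_injective {n : ℕ} (hn : n ≠ 0) {A B : IdealGroup E} (h : A ^ n = B ^ n) :
    A = B := by
  refine val_injective fun v => ?_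
  have := congrArg (val v) h
  rw [map_pow, map_pow] at this
  have h2 := congrArg Multiplicative.toAdd this
  rw [toAdd_pow, toAdd_pow] at h2
  exact Multiplicative.toAdd.injective (by simpa [hn] using h2)

theorem ofIdeal_mul {I J : Ideal (𝓞 E)} (hI : I ≠ ⊥) (hJ : J ≠ ⊥) :
    ofIdeal (I * J) (mul_ne_zero hI hJ) = ofIdeal I hI * ofIdeal J hJ :=
  Units.ext (FractionalIdeal.coeIdeal_mul _ _)

theorem exists_ofIdeal_div (A : IdealGroup E) :
    ∃ (I J : Ideal (𝓞 E)) (hI : I ≠ ⊥) (hJ : J ≠ ⊥), A = ofIdeal I hI / ofIdeal J hJ := by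
  have hd : Ideal.span {((A : FractionalIdeal (𝓞 E)⁰ E).den : 𝓞 E)} ≠ ⊥ := by simp
  have hn : (A : FractionalIdeal (𝓞 E)⁰ E).num ≠ ⊥ := by
    exact FractionalIdeal.num_eq_zero_iff.not.2 A.ne_zero
  refine ⟨_, _, hn, hd, ?_⟩
  rw [eq_div_iff_mul_eq', mul_comm]
  ext1
  rw [Units.val_mul]
  change ((Ideal.span _ : Ideal (𝓞 E)) : FractionalIdeal (𝓞 E)⁰ E) * _ = _
  have h2 := FractionalIdeal.den_mul_self_eq_num' (𝓞 E)⁰ E A.1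
  rw [FractionalIdeal.coeIdeal_span_singleton, h2]
  rfl

theorem hom_ext_of_primes {G : Type*} [CommGroup G] {f g : IdealGroup E →* G}
    (h : ∀ v : HeightOneSpectrum (𝓞 E), f (ofIdeal v.asIdeal v.ne_bot) =
      g (ofIdeal v.asIdeal v.ne_bot)) : f = g := by
  have key : ∀ (I : Ideal (𝓞 E)) (hI : I ≠ ⊥), f (ofIdeal I hI) = g (ofIdeal I hI) := by
    intro I
    induction I using UniqueFactorizationMonoid.induction_on_prime with
    | h₁ => intro hI; exact absurd rfl hI
    | h₂ x hx =>
      intro hI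
      have : ofIdeal x hI = 1 := by
        ext1
        obtain rfl := Ideal.isUnit_iff.1 hx
        exact FractionalIdeal.coeIdeal_top _
      rw [this, map_one, map_one]
    | h₃ a q ha hq ih =>
      intro hI
      have hq0 : q ≠ ⊥ := hq.ne_zero
      rw [ofIdeal_mul hq0 ha, map_mul, map_mul, ih ha,
        h ⟨q, Ideal.isPrime_of_prime hq, hq0⟩]
  ext A
  obtain ⟨I, J, hI, hJ, rfl⟩ := exists_ofIdeal_div A
  rw [map_div, map_div, key, key]

/-- Finiteness of the class group. Together with torsion-freeness it reduces identities between
homomorphisms of ideal groups to principal ideals, hence to identities between elements. -/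
theorem exists_pow_eq_toPrincipalIdeal (A : IdealGroup E) :
    ∃ h ≠ 0, ∃ a : Eˣ, A ^ h = toPrincipalIdeal (𝓞 E) E a := by
  have : Finite (IdealGroup E ⧸ (toPrincipalIdeal (𝓞 E) E).range) :=
    Finite.of_equiv _ (ClassGroup.equiv (R := 𝓞 E) E).toEquiv
  refine ⟨Nat.card (IdealGroup E ⧸ (toPrincipalIdeal (𝓞 E) E).range), Nat.card_pos.ne', ?_⟩
  have h := pow_card_eq_one' (x := (A : IdealGroup E ⧸ (toPrincipalIdeal (𝓞 E) E).range))
  rw [← QuotientGroup.mk_pow, QuotientGroup.eq_one_iff] at h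
  obtain ⟨a, ha⟩ := h
  exact ⟨a, ha.symm⟩

theorem extend_injective : Function.Injective (extend F E) :=
  Units.map_injective (FractionalIdeal.extendedHom_injective (𝓞 F) F E (𝓞 E))

theorem extend_ofIdeal (I : Ideal (𝓞 F)) (hI : I ≠ ⊥) :
    extend F E (ofIdeal I hI) = ofIdeal (I.map (algebraMap (𝓞 F) (𝓞 E)))
      (Ideal.map_ne_bot_of_ne_bot hI) :=
  Units.ext (FractionalIdeal.extendedHom_coeIdeal_eq_map _ _ I)

theorem relNorm_ofIdeal (I : Ideal (𝓞 E)) (hI : I ≠ ⊥) :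
    relNorm F E (ofIdeal I hI) = ofIdeal (Ideal.relNorm (𝓞 F) I)
      (by simpa using hI) := by
  ext1
  change relNormFun F E (I : FractionalIdeal (𝓞 E)⁰ E) = _
  rw [relNormFun_eq F E _ I ⊤ top_ne_bot (by simp)]
  simp [ofIdeal]

theorem toPrincipalIdeal_eq_ofIdeal_div {a b : 𝓞 E} (ha : a ≠ 0) (hb : b ≠ 0) {x : Eˣ}
    (hx : (x : E) = a / b) :
    toPrincipalIdeal (𝓞 E) E x = ofIdeal (Ideal.span {a}) (by simpa using ha) /
      ofIdeal (Ideal.span {b}) (by simpa using hb) := by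
  rw [eq_div_iff_mul_eq']
  ext1
  rw [Units.val_mul, coe_toPrincipalIdeal]
  simp only [ofIdeal, Units.val_mk0, FractionalIdeal.coeIdeal_span_singleton,
    FractionalIdeal.spanSingleton_mul_spanSingleton]
  congr 1
  rw [hx]
  have : (b : E) ≠ 0 := by simpa using hb
  field_simp

theorem extend_toPrincipalIdeal (x : Fˣ) :
    extend F E (toPrincipalIdeal (𝓞 F) F x) =
      toPrincipalIdeal (𝓞 E) E (Units.map (algebraMap F E : F →* E) x) := by
  obtain ⟨a, b, hb, hx⟩ := IsFractionRing.div_surjective (A := 𝓞 F) (x : F)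
  have hb' : b ≠ 0 := nonZeroDivisors.ne_zero hb
  have ha : a ≠ 0 := by
    rintro rfl
    exact x.ne_zero (by simpa using hx.symm)
  rw [toPrincipalIdeal_eq_ofIdeal_div ha hb' hx.symm, map_div, extend_ofIdeal, extend_ofIdeal]
  rw [toPrincipalIdeal_eq_ofIdeal_div (a := algebraMap (𝓞 F) (𝓞 E) a)
    (b := algebraMap (𝓞 F) (𝓞 E) b) (by simpa using ha) (by simpa using hb')]
  · simp only [Ideal.map_span, Set.image_singleton]
  · rw [Units.coe_map, ← hx]
    exact map_div₀ (algebraMap F E) _ _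

theorem relNorm_toPrincipalIdeal (x : Eˣ) :
    relNorm F E (toPrincipalIdeal (𝓞 E) E x) =
      toPrincipalIdeal (𝓞 F) F (Units.map (Algebra.norm F) x) := by
  obtain ⟨a, b, hb, hx⟩ := IsFractionRing.div_surjective (A := 𝓞 E) (x : E)
  have hb' : b ≠ 0 := nonZeroDivisors.ne_zero hb
  have ha : a ≠ 0 := by
    rintro rfl
    exact x.ne_zero (by simpa using hx.symm)
  rw [toPrincipalIdeal_eq_ofIdeal_div ha hb' hx.symm, map_div, relNorm_ofIdeal, relNorm_ofIdeal]
  rw [toPrincipalIdeal_eq_ofIdeal_div (a := Algebra.intNorm (𝓞 F) (𝓞 E) a)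
    (b := Algebra.intNorm (𝓞 F) (𝓞 E) b) (by simpa using ha) (by simpa using hb')]
  · simp only [Ideal.relNorm_singleton]
  · have hn (c : 𝓞 E) : ((Algebra.intNorm (𝓞 F) (𝓞 E) c : 𝓞 F) : F) =
        Algebra.norm F (algebraMap (𝓞 E) E c) :=
      Algebra.algebraMap_intNorm (A := 𝓞 F) (K := F) (L := E) (B := 𝓞 E) c
    rw [Units.coe_map, ← hx, hn, hn, eq_div_iff, ← map_mul, div_mul_cancel₀]
    · simpa using hb'
    · simpa [Algebra.norm_eq_zero_iff] using hb'

theorem relNorm_extend (A : IdealGroup F) :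
    relNorm F E (extend F E A) = A ^ Module.finrank F E := by
  obtain ⟨h, h0, a, ha⟩ := exists_pow_eq_toPrincipalIdeal A
  apply pow_left_injective h0
  rw [← map_pow, ← map_pow, ha, extend_toPrincipalIdeal, relNorm_toPrincipalIdeal, pow_right_comm,
    ha, ← map_pow]
  congr 1
  ext1
  simp [Algebra.norm_algebraMap]

end IdealGroups

/-! ### Valuations, ramification and the test for an ambiguous ideal to come from below -/

section Valuations

variable {F E : Type*} [Field F] [NumberField F] [Field E] [NumberField E] [Algebra F E]

open IsDedekindDomain

theorem toAdd_val (v : HeightOneSpectrum (𝓞 E)) (A : IdealGroup E) :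
    (val v A).toAdd = FractionalIdeal.count E v (A : FractionalIdeal (𝓞 E)⁰ E) := rfl

open Classical in
theorem val_prime (v w : HeightOneSpectrum (𝓞 E)) :
    (val v (ofIdeal w.asIdeal w.ne_bot)).toAdd = if w = v then 1 else 0 :=
  FractionalIdeal.count_maximal E v w

theorem val_ofIdeal_pow (v : HeightOneSpectrum (𝓞 E)) (I : Ideal (𝓞 E)) (hI : I ≠ ⊥) (n : ℕ) :
    val v (ofIdeal (I ^ n) (pow_ne_zero n hI)) = val v (ofIdeal I hI) ^ n := by
  rw [← map_pow]
  congr 1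
  exact Units.ext (FractionalIdeal.coeIdeal_pow (𝓞 E)⁰ E I n)

open Classical in
theorem val_extend_prime (v : HeightOneSpectrum (𝓞 F)) (w : HeightOneSpectrum (𝓞 E)) :
    (val w (extend F E (ofIdeal v.asIdeal v.ne_bot))).toAdd =
      if w.under (𝓞 F) = v then (w.asIdeal.ramificationIdx (𝓞 F) : ℤ) else 0 := by
  have h0 : v.asIdeal.map (algebraMap (𝓞 F) (𝓞 E)) ≠ ⊥ := Ideal.map_ne_bot_of_ne_bot v.ne_bot
  rw [extend_ofIdeal, toAdd_val]
  change FractionalIdeal.count E w ((v.asIdeal.map (algebraMap (𝓞 F) (𝓞 E)) : Ideal (𝓞 E)) :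
    FractionalIdeal (𝓞 E)⁰ E) = _
  rw [FractionalIdeal.count_coe E w h0, Ideal.count_associates_factors_eq h0 w.isPrime w.ne_bot]
  split_ifs with h
  · have : w.asIdeal.LiesOver v.asIdeal := ⟨by rw [← h]; rfl⟩
    rw [Ideal.IsDedekindDomain.ramificationIdx_eq_normalizedFactors_count v.asIdeal w.asIdeal h0]
  · rw [Nat.cast_eq_zero, Multiset.count_eq_zero]
    intro hw
    have hle := Ideal.dvd_iff_le.1 (UniqueFactorizationMonoid.dvd_of_mem_normalizedFactors hw)
    have := v.isMaximal.eq_of_le (w.under (𝓞 F)).isPrime.ne_top (Ideal.map_le_iff_le_comap.1 hle)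
    exact h (HeightOneSpectrum.ext this.symm)

theorem val_extend (w : HeightOneSpectrum (𝓞 E)) (A : IdealGroup F) :
    val w (extend F E A) = val (w.under (𝓞 F)) A ^ w.asIdeal.ramificationIdx (𝓞 F) := by
  have : (val w).comp (extend F E) =
      (powMonoidHom (w.asIdeal.ramificationIdx (𝓞 F))).comp (val (w.under (𝓞 F))) := by
    refine hom_ext_of_primes fun v => ?_
    apply Multiplicative.toAdd.injective
    classical
    rw [MonoidHom.comp_apply, MonoidHom.comp_apply, val_extend_prime, powMonoidHom_apply,
      toAdd_pow, val_prime]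
    simp only [eq_comm (a := v)]
    split_ifs <;> simp
  exact DFunLike.congr_fun this A

theorem val_relNorm (v : HeightOneSpectrum (𝓞 F)) (S : Finset (HeightOneSpectrum (𝓞 E)))
    (hS : ∀ w, w ∈ S ↔ w.under (𝓞 F) = v) (A : IdealGroup E) :
    val v (relNorm F E A) = ∏ w ∈ S, val w A ^ w.asIdeal.inertiaDeg (𝓞 F) := by
  have : (val v).comp (relNorm F E) =
      ∏ w ∈ S, (powMonoidHom (w.asIdeal.inertiaDeg (𝓞 F))).comp (val w) := by
    refine hom_ext_of_primes fun u => ?_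
    apply Multiplicative.toAdd.injective
    classical
    have hu := u.isMaximal
    have hu' := (u.under (𝓞 F)).isMaximal
    have : u.asIdeal.LiesOver (u.under (𝓞 F)).asIdeal := ⟨rfl⟩
    have h := Ideal.relNorm_eq_pow_of_isMaximal u.asIdeal (u.under (𝓞 F)).asIdeal
    rw [MonoidHom.comp_apply, relNorm_ofIdeal, MonoidHom.finsetProd_apply, toAdd_prod]
    simp only [MonoidHom.comp_apply, powMonoidHom_apply, toAdd_pow, h]
    rw [val_ofIdeal_pow _ _ (u.under (𝓞 F)).ne_bot, toAdd_pow, val_prime]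
    simp only [val_prime]
    by_cases hv : u.under (𝓞 F) = v
    · rw [Finset.sum_eq_single_of_mem u ((hS u).2 hv)]
      · simp [hv]
      · intro b _ hb
        simp [hb.symm]
    · rw [Finset.sum_eq_zero]
      · simp [hv]
      · intro b hb
        rw [if_neg (by rintro rfl; exact hv ((hS u).1 hb))]
        simp
  rw [← MonoidHom.comp_apply, this, MonoidHom.finsetProd_apply]
  rfl

theorem exists_val_eq (k : HeightOneSpectrum (𝓞 E) → ℤ) (hk : {v | k v ≠ 0}.Finite) :
    ∃ A : IdealGroup E, ∀ v, (val v A).toAdd = k v := by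
  classical
  refine ⟨∏ w ∈ hk.toFinset, ofIdeal w.asIdeal w.ne_bot ^ k w, fun v => ?_⟩
  rw [map_prod, toAdd_prod]
  simp only [map_zpow, toAdd_zpow, val_prime]
  by_cases hv : k v = 0
  · rw [hv]
    refine Finset.sum_eq_zero fun w _ => ?_
    split_ifs with h
    · subst h; simp [hv]
    · simp
  · rw [Finset.sum_eq_single_of_mem v (by simpa using hv) fun b _ hb => by simp [hb]]
    simp

theorem finite_val_ne_zero (A : IdealGroup E) : {v | (val v A).toAdd ≠ 0}.Finite :=
  FractionalIdeal.finite_factors (K := E) A.1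

theorem exists_pow_eq {n : ℕ} {A : IdealGroup E}
    (h : ∀ v, (n : ℤ) ∣ (val v A).toAdd) : ∃ B : IdealGroup E, A = B ^ n := by
  choose k hk using h
  -- The exponent is forced to be zero where `A` has valuation zero, so that the support is finite
  -- even if `n = 0`.
  obtain ⟨B, hB⟩ := exists_val_eq (fun v => if (val v A).toAdd = 0 then 0 else k v)
    ((finite_val_ne_zero A).subset fun v hv => by
      simp only [Set.mem_ofPred_eq, ne_eq, ite_eq_left_iff, not_forall] at hv
      exact hv.1)
  refine ⟨B, val_injective fun v => Multiplicative.toAdd.injective ?_⟩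
  rw [map_pow, toAdd_pow, hB, nsmul_eq_mul]
  split_ifs with h
  · rw [h, mul_zero]
  · exact hk v

section PrimesOver

variable (F E) in
theorem finrank_ringOfIntegers : Module.finrank (𝓞 F) (𝓞 E) = Module.finrank F E :=
  (IsFractionRing.finrank_eq (𝓞 F) F (𝓞 E) E).symm

theorem sum_ramificationIdx_mul_inertiaDeg (v : HeightOneSpectrum (𝓞 F)) [v.asIdeal.IsMaximal] :
    ∑ q : v.asIdeal.primesOver (𝓞 E), q.1.ramificationIdx (𝓞 F) * q.1.inertiaDeg (𝓞 F) =
      Module.finrank F E := by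
  rw [← finrank_ringOfIntegers F E]
  exact Ideal.sum_ramification_inertia_eq_finrank v.asIdeal (𝓞 E)

/-- A prime of `E`, as a prime over its restriction to `F`. -/
def primeOver (w : HeightOneSpectrum (𝓞 E)) :
    (w.under (𝓞 F)).asIdeal.primesOver (𝓞 E) :=
  ⟨w.asIdeal, w.isPrime, ⟨rfl⟩⟩

omit [NumberField F] [NumberField E] in
theorem under_eq_iff {v : HeightOneSpectrum (𝓞 F)} {w : HeightOneSpectrum (𝓞 E)} :
    w.under (𝓞 F) = v ↔ w.asIdeal ∈ v.asIdeal.primesOver (𝓞 E) :=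
  ⟨fun h => ⟨w.isPrime, ⟨by rw [← h]; rfl⟩⟩, fun h => HeightOneSpectrum.ext h.2.over.symm⟩

omit [NumberField F] [NumberField E] in
theorem exists_under_eq (v : HeightOneSpectrum (𝓞 F)) (q : v.asIdeal.primesOver (𝓞 E)) :
    ∃ w : HeightOneSpectrum (𝓞 E), w.under (𝓞 F) = v ∧ w.asIdeal = q := by
  refine ⟨⟨q, q.2.1, Ideal.ne_bot_of_mem_primesOver v.ne_bot q.2⟩, ?_, rfl⟩
  exact under_eq_iff.2 q.2

theorem ramificationIdx_le (w : HeightOneSpectrum (𝓞 E)) :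
    w.asIdeal.ramificationIdx (𝓞 F) ≤ Module.finrank F E := by
  have := (w.under (𝓞 F)).isMaximal
  rw [← sum_ramificationIdx_mul_inertiaDeg (E := E) (w.under (𝓞 F))]
  refine le_trans ?_ (Finset.single_le_sum (fun _ _ => Nat.zero_le _)
    (Finset.mem_univ (primeOver (F := F) w)))
  have := w.isPrime
  exact Nat.le_mul_of_pos_right _ (Ideal.inertiaDeg_pos w.asIdeal (𝓞 F))

/-- In `∑ e f = [E : F]` the term of `w` already exhausts the degree, leaving no room for another
prime. -/
theorem totallyRamified_of_ramificationIdx_eq (w : HeightOneSpectrum (𝓞 E))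
    (hw : w.asIdeal.ramificationIdx (𝓞 F) = Module.finrank F E) :
    TotallyRamified F w.asIdeal := by
  have := (w.under (𝓞 F)).isMaximal
  refine ⟨w.isPrime, w.ne_bot, (w.under (𝓞 F)).asIdeal, (w.under (𝓞 F)).isPrime, ?_⟩
  have hs := sum_ramificationIdx_mul_inertiaDeg (E := E) (w.under (𝓞 F))
  rw [← Finset.add_sum_erase _ _ (Finset.mem_univ (primeOver (F := F) w))] at hs
  change w.asIdeal.ramificationIdx (𝓞 F) * w.asIdeal.inertiaDeg (𝓞 F) + _ = _ at hs
  have hw' := w.isPrime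
  have h1 := Nat.le_mul_of_pos_right (w.asIdeal.ramificationIdx (𝓞 F))
    (Ideal.inertiaDeg_pos w.asIdeal (𝓞 F))
  have h0 : ∑ q ∈ Finset.univ.erase (primeOver (F := F) w),
      q.1.ramificationIdx (𝓞 F) * q.1.inertiaDeg (𝓞 F) = 0 := by omega
  have hall : ∀ q : (w.under (𝓞 F)).asIdeal.primesOver (𝓞 E), q = primeOver (F := F) w := by
    intro q
    by_contra hq
    have := (Finset.sum_eq_zero_iff.1 h0) q (by simpa using hq)
    have hq1 := q.2.1
    exact (Nat.mul_pos (Ideal.ramificationIdx_pos q.1 (𝓞 F))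
      (Ideal.inertiaDeg_pos q.1 (𝓞 F))).ne' this
  rw [Ideal.map_algebraMap_eq_finsetProd_pow (w.under (𝓞 F)).ne_bot,
    Finset.prod_eq_single_of_mem w.asIdeal]
  · rw [hw]
  · exact Set.mem_toFinset.2 (primeOver (F := F) w).2
  · intro b hb hb'
    exact absurd (congrArg Subtype.val (hall ⟨b, Set.mem_toFinset.1 hb⟩)) hb'

theorem ramificationIdx_eq_of_totallyRamified (w : HeightOneSpectrum (𝓞 E))
    (hw : TotallyRamified F w.asIdeal) :
    w.asIdeal.ramificationIdx (𝓞 F) = Module.finrank F E := by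
  classical
  obtain ⟨-, -, l, hl, h⟩ := hw
  have hl0 : l ≠ ⊥ := by
    rintro rfl
    rw [Ideal.map_bot] at h
    exact pow_ne_zero (Module.finrank F E) w.ne_bot h.symm
  let v : HeightOneSpectrum (𝓞 F) := ⟨l, hl, hl0⟩
  have h1 := val_extend_prime (E := E) v w
  rw [extend_ofIdeal] at h1
  simp only [v, h] at h1
  rw [val_ofIdeal_pow _ _ w.ne_bot, toAdd_pow, val_prime, if_pos rfl] at h1
  split_ifs at h1 with h2
  · simpa using h1.symm
  · have : Module.finrank F E ≠ 0 := Module.finrank_pos.ne'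
    simp [this] at h1

/-- In a quadratic extension, a prime is either undecomposed or the product of two different primes
of degree one. -/
theorem primes_over_of_finrank_eq_two (h2 : Module.finrank F E = 2)
    (v : HeightOneSpectrum (𝓞 F)) :
    (∃ w : HeightOneSpectrum (𝓞 E), (∀ u : HeightOneSpectrum (𝓞 E), u.under (𝓞 F) = v ↔ u = w) ∧
      w.asIdeal.inertiaDeg (𝓞 F) ≤ 2) ∨
    (SplitsIn E v.asIdeal ∧ ∃ w w' : HeightOneSpectrum (𝓞 E), w ≠ w' ∧
      (∀ u : HeightOneSpectrum (𝓞 E), u.under (𝓞 F) = v ↔ u = w ∨ u = w') ∧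
      w.asIdeal.inertiaDeg (𝓞 F) = 1 ∧ w'.asIdeal.inertiaDeg (𝓞 F) = 1) := by
  classical
  have := v.isMaximal
  have hs := sum_ramificationIdx_mul_inertiaDeg (E := E) v
  rw [h2] at hs
  have hpos : ∀ q : v.asIdeal.primesOver (𝓞 E),
      0 < q.1.ramificationIdx (𝓞 F) ∧ 0 < q.1.inertiaDeg (𝓞 F) := fun q => by
    have := q.2.1
    exact ⟨Ideal.ramificationIdx_pos q.1 (𝓞 F), Ideal.inertiaDeg_pos q.1 (𝓞 F)⟩
  have hcard : Fintype.card (v.asIdeal.primesOver (𝓞 E)) ≤ 2 := by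
    rw [← hs, ← Finset.card_univ, Finset.card_eq_sum_ones]
    exact Finset.sum_le_sum fun q _ => Nat.mul_pos (hpos q).1 (hpos q).2
  have hne : Fintype.card (v.asIdeal.primesOver (𝓞 E)) ≠ 0 := by
    intro h0
    rw [Fintype.card_eq_zero_iff] at h0
    simp at hs
  obtain h1 | h1 : Fintype.card (v.asIdeal.primesOver (𝓞 E)) = 1 ∨
      Fintype.card (v.asIdeal.primesOver (𝓞 E)) = 2 := by omega
  · left
    obtain ⟨q, hq⟩ := Fintype.card_eq_one_iff.1 h1
    obtain ⟨w, hw, hwq⟩ := exists_under_eq v q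
    refine ⟨w, fun u => ⟨fun h => ?_, by rintro rfl; exact hw⟩, ?_⟩
    · exact HeightOneSpectrum.ext
        ((congrArg Subtype.val (hq ⟨u.asIdeal, under_eq_iff.1 h⟩)).trans hwq.symm)
    · rw [hwq, ← hs]
      refine le_trans (Nat.le_mul_of_pos_left _ (hpos q).1) ?_
      exact Finset.single_le_sum (f := fun q : v.asIdeal.primesOver (𝓞 E) =>
        q.1.ramificationIdx (𝓞 F) * q.1.inertiaDeg (𝓞 F)) (fun _ _ => Nat.zero_le _)
        (Finset.mem_univ q)
  · right
    rw [← Finset.card_univ] at h1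
    obtain ⟨q, q', hqq, huniv⟩ := Finset.card_eq_two.1 h1
    rw [huniv, Finset.sum_pair hqq] at hs
    obtain ⟨he, hf⟩ := hpos q
    obtain ⟨he', hf'⟩ := hpos q'
    have hm : q.1.ramificationIdx (𝓞 F) * q.1.inertiaDeg (𝓞 F) = 1 := by
      have := Nat.mul_pos he hf
      have := Nat.mul_pos he' hf'
      omega
    have hm' : q'.1.ramificationIdx (𝓞 F) * q'.1.inertiaDeg (𝓞 F) = 1 := by omega
    obtain ⟨he1, hf1⟩ := mul_eq_one.1 hm
    obtain ⟨he1', hf1'⟩ := mul_eq_one.1 hm'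
    obtain ⟨w, hw, hwq⟩ := exists_under_eq v q
    obtain ⟨w', hw', hwq'⟩ := exists_under_eq v q'
    refine ⟨⟨q, q', q.2.1, q'.2.1, fun h => hqq (Subtype.ext h), ?_⟩, w, w', ?_, ?_, ?_, ?_⟩
    · rw [Ideal.map_algebraMap_eq_finsetProd_pow v.ne_bot, ← Finset.prod_set_coe, huniv,
        Finset.prod_pair hqq, he1, he1', pow_one, pow_one]
    · rintro rfl
      exact hqq (Subtype.ext (hwq.symm.trans hwq'))
    · refine fun u => ⟨fun h => ?_, by rintro (rfl | rfl) <;> assumption⟩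
      have hu := Finset.mem_univ (⟨u.asIdeal, under_eq_iff.1 h⟩ : v.asIdeal.primesOver (𝓞 E))
      rw [huniv, Finset.mem_insert, Finset.mem_singleton] at hu
      exact hu.imp (fun h => HeightOneSpectrum.ext ((congrArg Subtype.val h).trans hwq.symm))
        (fun h => HeightOneSpectrum.ext ((congrArg Subtype.val h).trans hwq'.symm))
    · rw [hwq, hf1]
    · rw [hwq', hf1']

end PrimesOver

/-- Write `A ^ p = b 𝓞_E`. At a prime `w` this reads `p · w(A) = e · v(b)`, where `v` is the prime
below. Either `p ∣ v(b)`, or `p ∣ e`; then `e = p`, `w` is totally ramified and `v(b) = w(A)` is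
divisible by assumption. So `b = c ^ p`, and `A = c 𝓞_E` by torsion-freeness. -/
theorem mem_baseIdeals_of_dvd_val {p : ℕ} (hp : p.Prime) (hEF : Module.finrank F E = p)
    {A : IdealGroup E} (hA : A ∈ ambiguous p F E)
    (h : ∀ w : HeightOneSpectrum (𝓞 E), TotallyRamified F w.asIdeal → (p : ℤ) ∣ (val w A).toAdd) :
    A ∈ baseIdeals F E := by
  obtain ⟨b, hb⟩ := hA
  have hb' : extend F E b = A ^ p := hb
  have key : ∀ v, (p : ℤ) ∣ (val v b).toAdd := by
    intro v
    have hv := v.isMaximal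
    obtain ⟨q⟩ : Nonempty (v.asIdeal.primesOver (𝓞 E)) := by
      by_contra hne
      rw [not_nonempty_iff] at hne
      have hs := sum_ramificationIdx_mul_inertiaDeg (E := E) v
      rw [Finset.univ_eq_empty, Finset.sum_empty, hEF] at hs
      exact hp.ne_zero hs.symm
    obtain ⟨w, rfl, -⟩ := exists_under_eq v q
    have hval : (p : ℤ) * (val w A).toAdd =
        w.asIdeal.ramificationIdx (𝓞 F) * (val (w.under (𝓞 F)) b).toAdd := by
      have := congrArg (fun B => (val w B).toAdd) hb'
      simpa [val_extend] using this.symm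
    have hpp : Prime (p : ℤ) := Nat.prime_iff_prime_int.1 hp
    rcases hpp.dvd_or_dvd ⟨_, hval.symm⟩ with hd | hd
    · have hle := ramificationIdx_le (F := F) w
      have hw := w.isPrime
      have he : w.asIdeal.ramificationIdx (𝓞 F) = Module.finrank F E := by
        have := Nat.le_of_dvd (Ideal.ramificationIdx_pos w.asIdeal (𝓞 F)) (Int.natCast_dvd_natCast.1 hd)
        omega
      have htr := totallyRamified_of_ramificationIdx_eq w he
      rw [he, hEF] at hval
      rw [← mul_left_cancel₀ hpp.ne_zero hval]
      exact h w htr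
    · exact hd
  obtain ⟨c, rfl⟩ := exists_pow_eq key
  rw [map_pow] at hb'
  exact ⟨c, pow_left_injective hp.ne_zero hb'⟩

theorem dvd_val_of_mem_baseIdeals {A : IdealGroup E} (hA : A ∈ baseIdeals F E)
    (w : HeightOneSpectrum (𝓞 E)) (hw : TotallyRamified F w.asIdeal) :
    (Module.finrank F E : ℤ) ∣ (val w A).toAdd := by
  obtain ⟨b, rfl⟩ := hA
  rw [val_extend, ramificationIdx_eq_of_totallyRamified w hw, toAdd_pow, nsmul_eq_mul]
  exact dvd_mul_right _ _

/-- Such primes divide the different, which is nonzero. -/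
theorem finite_totallyRamified (h1 : 1 < Module.finrank F E) :
    {w : HeightOneSpectrum (𝓞 E) | TotallyRamified F w.asIdeal}.Finite := by
  refine (Ideal.finite_factors (differentIdeal_ne_bot (A := 𝓞 F) (B := 𝓞 E))).subset ?_
  rintro w ⟨-, -, l, hl, h⟩
  have hl0 : l ≠ ⊥ := by
    rintro rfl
    rw [Ideal.map_bot] at h
    exact pow_ne_zero (Module.finrank F E) w.ne_bot h.symm
  have : l.IsMaximal := hl.isMaximal hl0
  refine (dvd_pow_self w.asIdeal ?_).trans
    (pow_sub_one_dvd_differentIdeal (𝓞 F) (p := l) w.asIdeal (Module.finrank F E) hl0 (by rw [h]))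
  omega

/-- The valuations at `T` modulo `p` map `H` to `𝔽_p ^ T`, and the kernel of this map lies in `B`.
-/
theorem relIndex_le_of_val {p : ℕ} (hp : p.Prime) {B H : Subgroup (IdealGroup E)}
    {T : Set (HeightOneSpectrum (𝓞 E))} (hT : T.Finite)
    (h : ∀ A ∈ H, (∀ w ∈ T, (p : ℤ) ∣ (val w A).toAdd) → A ∈ B) :
    B.relIndex H ≤ p ^ T.ncard := by
  have := hT.fintype
  have : NeZero p := ⟨hp.ne_zero⟩
  let φ : IdealGroup E →* Multiplicative (T → ZMod p) :=
    { toFun := fun A => Multiplicative.ofAdd fun w => ((val w.1 A).toAdd : ZMod p)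
      map_one' := by
        apply Multiplicative.toAdd.injective
        funext w
        simp
      map_mul' := fun A B => by
        apply Multiplicative.toAdd.injective
        funext w
        simp }
  have hle : φ.ker ⊓ H ≤ B := by
    rintro A ⟨hA, hAH⟩
    refine h A hAH fun w hw => ?_
    have := congrFun (congrArg Multiplicative.toAdd ((MonoidHom.mem_ker).1 hA)) ⟨w, hw⟩
    exact (ZMod.intCast_zmod_eq_zero_iff_dvd _ _).1 this
  have hfin : Finite (Multiplicative (T → ZMod p)) := inferInstanceAs (Finite (T → ZMod p))
  rw [← Subgroup.inf_relIndex_right B H]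
  calc _ ≤ (φ.ker ⊓ H).relIndex H := by
        refine Subgroup.relIndex_le_of_le_left (le_inf hle inf_le_right) ?_
        rw [Subgroup.inf_relIndex_right, Subgroup.relIndex_ker]
        exact Nat.card_pos.ne'
    _ = Nat.card (H.map φ) := by rw [Subgroup.inf_relIndex_right, Subgroup.relIndex_ker]
    _ ≤ Nat.card (Multiplicative (T → ZMod p)) := Subgroup.card_le_card_group _
    _ = p ^ T.ncard := by
      change Nat.card (T → ZMod p) = _
      rw [Nat.card_fun, Nat.card_zmod, Nat.card_coe_set_eq]

end Valuations

section Herbrand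

open MonoidHom in
/-- The Herbrand quotient of a finitely generated abelian group, written multiplicatively, with an
automorphism of prime order `p`. -/
theorem herbrand_quotient_eq_mul {U : Type*} [CommGroup U] [AddGroup.FG (Additive U)] {p : ℕ}
    (hp : p.Prime) (σ D T : U →* U) (hσ : ∀ x, σ^[p] x = x) (hD : ∀ x, D x = x / σ x)
    (hT : ∀ x, T x = ∏ i ∈ Finset.range p, σ^[i] x) :
    Module.finrank ℤ (Additive U) =
      Module.finrank ℤ (Additive D.ker) + Module.finrank ℤ (Additive T.ker) ∧
    T.range.relIndex D.ker ≠ 0 ∧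
    (T.range.relIndex D.ker) ^ (p - 1) * p ^ Module.finrank ℤ (Additive T.ker) =
      (D.range.relIndex T.ker) ^ (p - 1) * p ^ ((p - 1) * Module.finrank ℤ (Additive D.ker)) := by
  let σ' : AddMonoid.End (Additive U) := toAdditive σ
  let D' : AddMonoid.End (Additive U) := toAdditive D
  let T' : AddMonoid.End (Additive U) := toAdditive T
  have hpow : ∀ i (x : Additive U), (σ' ^ i) x = Additive.ofMul (σ^[i] x.toMul) := by
    intro i
    induction i with
    | zero => intro x; rfl
    | succ n ih => intro x; rw [pow_succ, end_mul_apply, ih]; rfl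
  have h1 : σ' ^ p = 1 := by
    ext x
    rw [hpow, hσ]
    rfl
  have h2 : D' = 1 - σ' := by
    ext x
    exact congrArg Additive.ofMul (hD x.toMul)
  have h3 : T' = ∑ i ∈ Finset.range p, σ' ^ i := by
    ext x
    have h4 : (∑ i ∈ Finset.range p, σ' ^ i : AddMonoid.End (Additive U)) x =
      ∑ i ∈ Finset.range p, (σ' ^ i : AddMonoid.End (Additive U)) x :=
        AddMonoidHom.finsetSum_apply _ _ _
    rw [h4]
    simp only [hpow]
    rw [← ofMul_prod]
    exact congrArg Additive.ofMul (hT x.toMul)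
  exact herbrand_quotient_eq hp h1 h2 h3

end Herbrand

/-! ### Hilbert 90 and ambiguous principal ideals of a cyclic extension -/

section Cyclic

variable {K N : Type*} [Field K] [NumberField K] [Field N] [NumberField N] [Algebra K N]

theorem ker_toPrincipalIdeal (E : Type*) [Field E] [NumberField E] :
    (toPrincipalIdeal (𝓞 E) E).ker = (Units.map (algebraMap (𝓞 E) E : 𝓞 E →* E)).range := by
  have key : ∀ x : Eˣ, x ∈ (toPrincipalIdeal (𝓞 E) E).ker → ∃ y : 𝓞 E, algebraMap (𝓞 E) E y = x := by
    intro x hx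
    have h := congrArg Units.val ((MonoidHom.mem_ker).1 hx)
    rw [coe_toPrincipalIdeal] at h
    have h2 := FractionalIdeal.mem_spanSingleton_self (𝓞 E)⁰ (x : E)
    rw [h] at h2
    exact (FractionalIdeal.mem_one_iff _).1 h2
  ext x
  constructor
  · intro hx
    obtain ⟨y, hy⟩ := key x hx
    obtain ⟨z, hz⟩ := key x⁻¹ (inv_mem hx)
    have hyz : y * z = 1 := by
      apply FaithfulSMul.algebraMap_injective (𝓞 E) E
      rw [map_mul, hy, hz, map_one, ← Units.val_mul, mul_inv_cancel, Units.val_one]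
    exact ⟨⟨y, z, hyz, by rw [mul_comm, hyz]⟩, Units.ext hy⟩
  · rintro ⟨u, rfl⟩
    rw [MonoidHom.mem_ker]
    ext1
    rw [coe_toPrincipalIdeal]
    have := FractionalIdeal.coeIdeal_span_singleton (S := (𝓞 E)⁰) (P := E) (u : 𝓞 E)
    rw [Ideal.span_singleton_eq_top.2 u.isUnit] at this
    exact this.symm.trans (FractionalIdeal.coeIdeal_top _)

/-- The homomorphism `x ↦ x / σ x` on the multiplicative group of `N`. -/
def divAut (σ : N ≃ₐ[K] N) : Nˣ →* Nˣ :=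
  MonoidHom.id _ / Units.map (σ : N →* N)

omit [NumberField K] [NumberField N] in
theorem divAut_apply (σ : N ≃ₐ[K] N) (x : Nˣ) : divAut σ x = x / Units.map (σ : N →* N) x := rfl

variable (K N) in
/-- The homomorphism induced by the norm on the multiplicative group of `N`. -/
def normAut : Nˣ →* Nˣ := (Units.map (algebraMap K N : K →* N)).comp (Units.map (Algebra.norm K))

variable [IsGalois K N] {σ : N ≃ₐ[K] N} (hσ : ∀ τ, τ ∈ Subgroup.zpowers σ)

include hσ in
theorem ker_divAut : (divAut σ).ker = (Units.map (algebraMap K N : K →* N)).range := by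
  ext x
  rw [MonoidHom.mem_ker, divAut_apply, div_eq_one]
  constructor
  · intro h
    have h1 : σ (x : N) = x := (congrArg Units.val h).symm
    have h2 : ∀ τ : N ≃ₐ[K] N, τ (x : N) = x := by
      intro τ
      have : Subgroup.zpowers σ ≤ MulAction.stabilizer (N ≃ₐ[K] N) (x : N) := by
        rw [Subgroup.zpowers_le]
        exact h1
      exact this (hσ τ)
    obtain ⟨y, hy⟩ := (IsGalois.mem_range_algebraMap_iff_fixed (F := K) (x : N)).2 h2
    have hy0 : y ≠ 0 := by
      rintro rfl
      exact x.ne_zero (by simpa using hy.symm)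
    exact ⟨Units.mk0 y hy0, Units.ext hy⟩
  · rintro ⟨y, rfl⟩
    ext
    simp

include hσ in
theorem normAut_eq_prod {p : ℕ} (hN : Module.finrank K N = p) (x : Nˣ) :
    normAut K N x = ∏ i ∈ Finset.range p, (Units.map (σ : N →* N))^[i] x := by
  have hord : orderOf σ = p := by
    rw [orderOf_eq_card_of_forall_mem_zpowers hσ, IsGalois.card_aut_eq_finrank, hN]
  have hpow : ∀ i, (((Units.map (σ : N →* N))^[i] x : Nˣ) : N) = (σ ^ i) (x : N) := by
    intro i
    induction i with
    | zero => rfl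
    | succ n ih => rw [Function.iterate_succ_apply', pow_succ', AlgEquiv.mul_apply, ← ih]; rfl
  ext
  rw [Units.coe_prod]
  simp only [hpow]
  change algebraMap K N (Algebra.norm K (x : N)) = _
  rw [Algebra.norm_eq_prod_automorphisms, ← hord]
  refine (Finset.prod_nbij (fun i => σ ^ i) (by simp) ?_ ?_ (fun _ _ => rfl)).symm
  · intro i hi j hj h
    exact pow_injOn_Iio_orderOf (by simpa using hi) (by simpa using hj) h
  · intro τ _
    obtain ⟨n, hn⟩ := (mem_powers_iff_mem_zpowers).2 (hσ τ)
    have h0 : 0 < orderOf σ := orderOf_pos σ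
    exact ⟨n % orderOf σ, by simpa using Nat.mod_lt _ h0, by rw [← hn]; exact pow_mod_orderOf σ n⟩

include hσ in
/-- Hilbert's Theorem 90. -/
theorem exists_divAut_eq {x : Nˣ} (hx : normAut K N x = 1) : ∃ y, divAut σ y = x := by
  set s : Nˣ →* Nˣ := Units.map (σ : N →* N) with hs
  -- Since `x` has norm one, these partial norms depend only on `n` modulo the order of `σ`, so `σ ^
  -- n ↦ c n` is a well-defined cocycle with value `x` at `σ`.
  let c : ℕ → Nˣ := fun n => ∏ i ∈ Finset.range n, s^[i] x
  have hspow : ∀ n (y : Nˣ), s^[n] y = (σ ^ n) • y := by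
    intro n y
    induction n with
    | zero => simp
    | succ n ih => rw [Function.iterate_succ_apply', ih, pow_succ', mul_smul]; rfl
  have hcadd : ∀ m n, c (m + n) = c m * s^[m] (c n) := by
    intro m n
    simp only [c, Finset.prod_range_add, hspow, Finset.smul_prod', pow_add, mul_smul]
  have hcq : ∀ n k, c (n + orderOf σ * k) = c n := by
    have h0 : c (orderOf σ) = 1 := by
      rw [← hx, normAut_eq_prod hσ rfl, ← IsGalois.card_aut_eq_finrank,
        ← orderOf_eq_card_of_forall_mem_zpowers hσ]
    intro n k
    induction k with
    | zero => rfl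
    | succ k ih => rw [mul_add, mul_one, ← add_assoc, hcadd, h0, hspow, smul_one, mul_one, ih]
  have hcmod : ∀ m n, m % orderOf σ = n % orderOf σ → c m = c n := by
    intro m n h
    rw [← Nat.mod_add_div m (orderOf σ), ← Nat.mod_add_div n (orderOf σ), hcq, hcq, h]
  have hex : ∀ τ : N ≃ₐ[K] N, ∃ n : ℕ, σ ^ n = τ := fun τ =>
    (mem_powers_iff_mem_zpowers).2 (hσ τ)
  choose e he using hex
  have hcoc : groupCohomology.IsMulCocycle₁ (fun τ => c (e τ)) := by
    intro g h
    have h1 : c (e (g * h)) = c (e g + e h) := by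
      apply hcmod
      refine pow_eq_pow_iff_modEq.1 ?_
      rw [pow_add, he, he, he]
    simp only [h1, hcadd, hspow, he]
    rw [mul_comm]
  obtain ⟨β, hβ⟩ := groupCohomology.isMulCoboundary₁_of_isMulCocycle₁_of_aut_to_units _ hcoc
  -- The coboundary is `σ β / β`, whereas `divAut` divides by the conjugate; hence the inverse.
  refine ⟨β⁻¹, ?_⟩
  have h2 : c (e σ) = x := by
    rw [hcmod (e σ) 1 (pow_eq_pow_iff_modEq.1 (by rw [he, pow_one]))]
    simp [c]
  rw [← h2, show c (e σ) = _ from (hβ σ).symm, divAut_apply, map_inv]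
  simp only [div_eq_mul_inv, inv_inv, AlgEquiv.smul_units_def]
  rw [mul_comm]

include hσ in
theorem range_divAut : (divAut σ).range = (normAut K N).ker := by
  ext x
  rw [MonoidHom.mem_ker]
  constructor
  · rintro ⟨y, rfl⟩
    rw [divAut_apply, map_div, div_eq_one]
    ext
    simp [normAut, Algebra.norm_eq_of_algEquiv]
  · intro h
    exact exists_divAut_eq hσ h

section AmbiguousPrincipal

omit [IsGalois K N] [NumberField K] in
theorem map_aut_mem_unitRange {x : Nˣ} (τ : N ≃ₐ[K] N)
    (hx : x ∈ (toPrincipalIdeal (𝓞 N) N).ker) :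
    Units.map (τ : N →* N) x ∈ (toPrincipalIdeal (𝓞 N) N).ker := by
  rw [ker_toPrincipalIdeal] at *
  obtain ⟨u, rfl⟩ := hx
  exact ⟨Units.map (NumberField.RingOfIntegers.mapRingHom (τ : N →+* N) : 𝓞 N →* 𝓞 N) u, Units.ext rfl⟩

omit [IsGalois K N] [NumberField K] in
theorem ker_toPrincipalIdeal_le_comap (τ : N ≃ₐ[K] N) :
    (toPrincipalIdeal (𝓞 N) N).ker ≤ (toPrincipalIdeal (𝓞 N) N).ker.comap (divAut τ) := by
  intro x hx
  rw [Subgroup.mem_comap, divAut_apply]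
  exact div_mem hx (map_aut_mem_unitRange τ hx)

omit [IsGalois K N] [NumberField K] [NumberField N] in
theorem divAut_map_algebraMap (τ : N ≃ₐ[K] N) (x : Kˣ) :
    divAut τ (Units.map (algebraMap K N : K →* N) x) = 1 := by
  rw [divAut_apply, div_eq_one]
  ext
  simp

include hσ in
/-- The ambiguous principal ideals are generated by the elements `a` such that `a / σ a` is a
unit. -/
theorem ambiguousPrincipal_eq_map {p : ℕ} (hp : p ≠ 0) (hN : Module.finrank K N = p) :
    ambiguousPrincipal p K N =
      ((toPrincipalIdeal (𝓞 N) N).ker.comap (divAut σ)).map (toPrincipalIdeal (𝓞 N) N) := by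
  ext A
  constructor
  · rintro ⟨⟨b, hb⟩, a, rfl⟩
    refine ⟨a, ?_, rfl⟩
    have hb' : extend K N b = toPrincipalIdeal (𝓞 N) N a ^ p := hb
    -- With `b ^ h = (β)`, the element `a ^ (p h) / β` is a unit. Applying `divAut σ` removes `β ∈
    -- K`, so a power of the ideal of `a / σ a` is trivial, hence that ideal itself is.
    obtain ⟨h, h0, β, hβ⟩ := exists_pow_eq_toPrincipalIdeal b
    have h1 : toPrincipalIdeal (𝓞 N) N (Units.map (algebraMap K N : K →* N) β) =
        toPrincipalIdeal (𝓞 N) N (a ^ (p * h)) := by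
      rw [← extend_toPrincipalIdeal, ← hβ, map_pow, map_pow, hb', pow_mul]
    have h2 : a ^ (p * h) / Units.map (algebraMap K N : K →* N) β ∈
        (toPrincipalIdeal (𝓞 N) N).ker := by
      rw [MonoidHom.mem_ker, map_div, h1, div_self']
    have h3 := ker_toPrincipalIdeal_le_comap σ h2
    rw [Subgroup.mem_comap, map_div, divAut_map_algebraMap, div_one, map_pow,
      MonoidHom.mem_ker, map_pow] at h3
    exact pow_left_injective (mul_ne_zero hp h0) (h3.trans (one_pow _).symm)
  · rintro ⟨a, ha, rfl⟩
    refine ⟨?_, a, rfl⟩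
    have h1 : ∀ x : Nˣ, divAut σ x ∈ (toPrincipalIdeal (𝓞 N) N).ker →
        toPrincipalIdeal (𝓞 N) N (Units.map (σ : N →* N) x) = toPrincipalIdeal (𝓞 N) N x := by
      intro x hx
      rw [MonoidHom.mem_ker, divAut_apply, map_div, div_eq_one] at hx
      exact hx.symm
    have h2 : ∀ (i : ℕ) (x : Nˣ), divAut σ x ∈ (toPrincipalIdeal (𝓞 N) N).ker →
        toPrincipalIdeal (𝓞 N) N ((Units.map (σ : N →* N))^[i] x) =
          toPrincipalIdeal (𝓞 N) N x := by
      intro i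
      induction i with
      | zero => intro x _; rfl
      | succ n ih =>
        intro x hx
        rw [Function.iterate_succ_apply, ih _ ?_, h1 x hx]
        have h4 := map_aut_mem_unitRange σ hx
        rwa [divAut_apply, map_div, ← divAut_apply] at h4
    -- The ideal `(a)` is fixed by `σ`, so its `p`-th power is the product of its conjugates, the
    -- ideal generated by the norm of `a`.
    refine ⟨toPrincipalIdeal (𝓞 K) K (Units.map (Algebra.norm K) a), ?_⟩
    rw [extend_toPrincipalIdeal]
    change toPrincipalIdeal (𝓞 N) N (normAut K N a) = toPrincipalIdeal (𝓞 N) N a ^ p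
    rw [normAut_eq_prod hσ hN, map_prod]
    rw [Finset.prod_congr rfl fun i _ => h2 i a ha, Finset.prod_const, Finset.card_range]

omit [IsGalois K N] in
theorem basePrincipal_eq_map :
    basePrincipal K N =
      (Units.map (algebraMap K N : K →* N)).range.map (toPrincipalIdeal (𝓞 N) N) := by
  ext A
  constructor
  · rintro ⟨_, ⟨x, rfl⟩, rfl⟩
    exact ⟨_, ⟨x, rfl⟩, (extend_toPrincipalIdeal x).symm⟩
  · rintro ⟨_, ⟨x, rfl⟩, rfl⟩
    exact ⟨_, ⟨x, rfl⟩, extend_toPrincipalIdeal x⟩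

include hσ in
-- With `U` the units inside `Nˣ` and `D = divAut σ`, both sides are the index of `Kˣ U` in
-- `D⁻¹(U)`: on the left after taking principal ideals, with kernel `U`; on the right after applying
-- `D`, with kernel `Kˣ`. Hilbert 90 identifies `U ∩ D(Nˣ)` with the units of norm one.
theorem relIndex_basePrincipal {p : ℕ} (hp : p ≠ 0) (hN : Module.finrank K N = p) :
    (basePrincipal K N).relIndex (ambiguousPrincipal p K N) =
      ((toPrincipalIdeal (𝓞 N) N).ker.map (divAut σ)).relIndex
        ((toPrincipalIdeal (𝓞 N) N).ker ⊓ (normAut K N).ker) := by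
  have hk : (divAut σ).ker ≤ (toPrincipalIdeal (𝓞 N) N).ker.comap (divAut σ) := fun x hx => by
    rw [Subgroup.mem_comap, (MonoidHom.mem_ker).1 hx]
    exact one_mem _
  rw [ambiguousPrincipal_eq_map hσ hp hN, basePrincipal_eq_map, ← ker_divAut hσ,
    Subgroup.relIndex_map_map, sup_eq_left.2 (ker_toPrincipalIdeal_le_comap σ),
    ← range_divAut hσ, inf_comm, ← Subgroup.map_comap_eq, Subgroup.relIndex_map_map,
    sup_eq_left.2 hk, sup_comm]

end AmbiguousPrincipal

end Cyclic

/-! ### Tate cohomology of the unit group -/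

section UnitGroups

open NumberField

variable {K N : Type*} [Field K] [NumberField K] [Field N] [NumberField N] [Algebra K N]

instance (E : Type*) [Field E] [NumberField E] : AddGroup.FG (Additive (𝓞 E)ˣ) :=
  Module.Finite.iff_addGroup_fg.1 inferInstance

/-- The inclusion of the unit group in the multiplicative group of the field. -/
def unitIncl (E : Type*) [Field E] [NumberField E] : (𝓞 E)ˣ →* Eˣ :=
  Units.map (algebraMap (𝓞 E) E : 𝓞 E →* E)

theorem unitIncl_injective (E : Type*) [Field E] [NumberField E] :
    Function.Injective (unitIncl E) :=
  Units.map_injective (FaithfulSMul.algebraMap_injective (𝓞 E) E)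

/-- The action of an automorphism on units. -/
def unitAut (σ : N ≃ₐ[K] N) : (𝓞 N)ˣ →* (𝓞 N)ˣ :=
  Units.map (RingOfIntegers.mapRingHom (σ : N →+* N) : 𝓞 N →* 𝓞 N)

variable (K N) in
/-- The inclusion of the unit groups induced by an extension of fields. -/
def unitExt : (𝓞 K)ˣ →* (𝓞 N)ˣ := Units.map (algebraMap (𝓞 K) (𝓞 N) : 𝓞 K →* 𝓞 N)

variable (K N) in
/-- The norm of units. -/
def unitNorm : (𝓞 N)ˣ →* (𝓞 K)ˣ := Units.map (RingOfIntegers.norm K : 𝓞 N →* 𝓞 K)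

omit [NumberField K] [NumberField N] in
theorem unitExt_injective : Function.Injective (unitExt K N) :=
  Units.map_injective (FaithfulSMul.algebraMap_injective (𝓞 K) (𝓞 N))

omit [NumberField K] in
theorem unitIncl_unitAut_iterate (σ : N ≃ₐ[K] N) (n : ℕ) (u : (𝓞 N)ˣ) :
    unitIncl N ((unitAut σ)^[n] u) = (Units.map (σ : N →* N))^[n] (unitIncl N u) := by
  induction n generalizing u with
  | zero => rfl
  | succ n ih =>
    rw [Function.iterate_succ_apply, ih, Function.iterate_succ_apply]
    rfl

/-- The endomorphism `u ↦ u / σ u` of the unit group. -/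
def unitDiv (σ : N ≃ₐ[K] N) : (𝓞 N)ˣ →* (𝓞 N)ˣ := MonoidHom.id _ / unitAut σ

omit [NumberField K] in
theorem unitIncl_div_unitAut (σ : N ≃ₐ[K] N) (u : (𝓞 N)ˣ) :
    unitIncl N (unitDiv σ u) = divAut σ (unitIncl N u) := by
  rw [unitDiv, MonoidHom.div_apply, map_div]
  rfl

theorem unitIncl_unitExt (u : (𝓞 K)ˣ) :
    unitIncl N (unitExt K N u) = Units.map (algebraMap K N : K →* N) (unitIncl K u) :=
  Units.ext rfl

theorem unitIncl_unitExt_unitNorm (u : (𝓞 N)ˣ) :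
    unitIncl N (unitExt K N (unitNorm K N u)) = normAut K N (unitIncl N u) := by
  rw [unitIncl_unitExt]
  rfl

variable [IsGalois K N] {σ : N ≃ₐ[K] N} (hσ : ∀ τ, τ ∈ Subgroup.zpowers σ)

include hσ in
theorem ker_div_unitAut : (unitDiv σ).ker = (unitExt K N).range := by
  ext u
  rw [MonoidHom.mem_ker]
  constructor
  · intro h
    have h1 : unitIncl N u ∈ (divAut σ).ker := by
      rw [MonoidHom.mem_ker, ← unitIncl_div_unitAut, h, map_one]
    rw [ker_divAut hσ] at h1
    obtain ⟨y, hy⟩ := h1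
    -- The ideal of `y` becomes trivial in `N`, and extension of ideals is injective, so `y` is a
    -- unit of `K`.
    have h2 : y ∈ (toPrincipalIdeal (𝓞 K) K).ker := by
      rw [MonoidHom.mem_ker]
      apply extend_injective (E := N)
      rw [extend_toPrincipalIdeal, hy, map_one, ← MonoidHom.mem_ker, ker_toPrincipalIdeal]
      exact ⟨u, rfl⟩
    rw [ker_toPrincipalIdeal] at h2
    obtain ⟨v, rfl⟩ := h2
    exact ⟨v, unitIncl_injective N ((unitIncl_unitExt v).trans hy)⟩
  · rintro ⟨v, rfl⟩
    apply unitIncl_injective N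
    rw [unitIncl_div_unitAut, unitIncl_unitExt, divAut_map_algebraMap, map_one]

include hσ in
theorem index_unitNorms_eq_relIndex : (unitNorms K N).index =
    ((unitExt K N).comp (unitNorm K N)).range.relIndex (unitDiv σ).ker := by
  rw [ker_div_unitAut hσ, MonoidHom.range_eq_map (unitExt K N), MonoidHom.range_comp,
    Subgroup.relIndex_map_map_of_injective _ _ (unitExt_injective (K := K) (N := N)), Subgroup.relIndex_top_right]
  rfl

include hσ in
theorem relIndex_basePrincipal_eq_units {p : ℕ} (hp : p ≠ 0) (hN : Module.finrank K N = p) :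
    (basePrincipal K N).relIndex (ambiguousPrincipal p K N) =
      (unitDiv σ).range.relIndex ((unitExt K N).comp (unitNorm K N)).ker := by
  rw [relIndex_basePrincipal hσ hp hN,
    ← Subgroup.relIndex_map_map_of_injective _ _ (unitIncl_injective N), ker_toPrincipalIdeal]
  congr 1
  · ext x
    constructor
    · rintro ⟨_, ⟨u, rfl⟩, rfl⟩
      exact ⟨_, ⟨u, rfl⟩, unitIncl_div_unitAut σ u⟩
    · rintro ⟨_, ⟨u, rfl⟩, rfl⟩
      exact ⟨_, ⟨u, rfl⟩, (unitIncl_div_unitAut σ u).symm⟩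
  · ext x
    constructor
    · rintro ⟨⟨u, rfl⟩, h⟩
      refine ⟨u, unitIncl_injective N ?_, rfl⟩
      exact (unitIncl_unitExt_unitNorm u).trans (h.trans (map_one _).symm)
    · rintro ⟨u, hu, rfl⟩
      refine ⟨⟨u, rfl⟩, ?_⟩
      have := congrArg (unitIncl N) (MonoidHom.mem_ker.1 hu)
      rw [map_one] at this
      exact (unitIncl_unitExt_unitNorm u).symm.trans this

include hσ in
theorem finrank_ker_div_unitAut :
    Module.finrank ℤ (Additive (unitDiv σ).ker) = Units.rank K := by
  rw [← Units.finrank_eq K]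
  have e : (𝓞 K)ˣ ≃* (unitDiv σ).ker :=
    (MonoidHom.ofInjective (unitExt_injective (K := K) (N := N))).trans
      (MulEquiv.subgroupCongr (ker_div_unitAut hσ).symm)
  exact (MulEquiv.toAdditive e).symm.toIntLinearEquiv.finrank_eq

include hσ in
/-- The order of `P_{N/K} / P_K` is `p` times the index of the norms of units, by the Herbrand
quotient of the unit group. -/
theorem relIndex_basePrincipal_eq_mul_index {p : ℕ} (hp : p.Prime) (hp2 : p ≠ 2)
    (hN : Module.finrank K N = p) :
    (unitNorms K N).index ≠ 0 ∧
    (basePrincipal K N).relIndex (ambiguousPrincipal p K N) = p * (unitNorms K N).index := by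
  have hiter : ∀ u, (unitAut σ)^[p] u = u := by
    intro u
    apply unitIncl_injective N
    rw [unitIncl_unitAut_iterate]
    have hpow : ∀ n (y : Nˣ), (Units.map (σ : N →* N))^[n] y = (σ ^ n) • y := by
      intro n y
      induction n with
      | zero => simp
      | succ n ih => rw [Function.iterate_succ_apply', ih, pow_succ', mul_smul]; rfl
    have hord : σ ^ p = 1 := by
      rw [← hN, ← IsGalois.card_aut_eq_finrank]
      exact pow_card_eq_one'
    rw [hpow, hord, one_smul]
  have hprod : ∀ u, (unitExt K N).comp (unitNorm K N) u =
      ∏ i ∈ Finset.range p, (unitAut σ)^[i] u := by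
    intro u
    apply unitIncl_injective N
    rw [map_prod, MonoidHom.comp_apply, unitIncl_unitExt_unitNorm, normAut_eq_prod hσ hN]
    exact Finset.prod_congr rfl fun i _ => (unitIncl_unitAut_iterate σ i u).symm
  obtain ⟨h1, h2, h3⟩ := herbrand_quotient_eq_mul hp (unitAut σ)
    (unitDiv σ) ((unitExt K N).comp (unitNorm K N)) hiter (fun _ => rfl) hprod
  rw [← index_unitNorms_eq_relIndex hσ] at h2 h3
  rw [← relIndex_basePrincipal_eq_units hσ hp.ne_zero hN, finrank_ker_div_unitAut hσ] at h3
  rw [finrank_ker_div_unitAut hσ, Units.finrank_eq] at h1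
  refine ⟨h2, ?_⟩
  -- Odd degree leaves the infinite places unramified, so `N` has `p` times as many as `K`. The
  -- kernel of the norm on units then has rank `(p - 1)(r + 1)` with `r` the unit rank of `K`, and
  -- the Herbrand identity becomes an equality of `(p - 1)`-st powers.
  have hodd : Odd (Module.finrank K N) := by
    rw [hN]; exact hp.odd_of_ne_two hp2
  have := IsUnramifiedAtInfinitePlaces_of_odd_finrank hodd
  have hc := IsUnramifiedAtInfinitePlaces.card_infinitePlace K N
  rw [hN] at hc
  have hK0 : 0 < Fintype.card (InfinitePlace K) := Fintype.card_pos
  have hrK : Units.rank K + 1 = Fintype.card (InfinitePlace K) := by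
    rw [Units.rank]; omega
  have hrN : Units.rank N + 1 = Fintype.card (InfinitePlace N) := by
    have : 0 < Fintype.card (InfinitePlace N) := Fintype.card_pos
    rw [Units.rank]; omega
  obtain ⟨q, hq⟩ : ∃ q, p = q + 1 := ⟨p - 1, (Nat.succ_pred hp.ne_zero).symm⟩
  have hT : Module.finrank ℤ (Additive ((unitExt K N).comp (unitNorm K N)).ker) =
      (Units.rank K + 1) * (p - 1) := by
    have : Units.rank N + 1 = (Units.rank K + 1) * (p - 1) + (Units.rank K + 1) := by
      rw [hrN, hc, hrK, hq, Nat.add_sub_cancel]; ring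
    omega
  rw [hT, pow_mul, ← mul_pow, mul_comm (p - 1), pow_mul, ← mul_pow] at h3
  have hp1 : p - 1 ≠ 0 := by have := hp.one_lt; omega
  have h4 := Nat.pow_left_injective hp1 h3
  have h5 : p ^ Units.rank K ≠ 0 := pow_ne_zero _ hp.ne_zero
  refine Nat.eq_of_mul_eq_mul_right (Nat.pos_of_ne_zero h5) ?_
  rw [← h4]
  ring

theorem card_ker_nsmul_units {p : ℕ} (hp : p.Prime) (E : Type*) [Field E] [NumberField E] :
    Nat.card (nsmulAddMonoidHom (α := Additive (𝓞 E)ˣ) p).ker = p ^ (1 - theta p E) := by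
  have h0 : Nat.card (nsmulAddMonoidHom (α := Additive (𝓞 E)ˣ) p).ker =
      Nat.card (rootsOfUnity p (𝓞 E)) :=
    Nat.card_congr (Equiv.subtypeEquiv Additive.toMul fun a => Iff.rfl)
  have : NeZero p := ⟨hp.ne_zero⟩
  rw [h0, theta]
  split_ifs with h
  · obtain ⟨ζ, hζ⟩ := h
    have hint : IsPrimitiveRoot hζ.toInteger p := hζ.toInteger_isPrimitiveRoot
    rw [hint.card_rootsOfUnity, Nat.sub_zero, pow_one]
  · rw [Nat.sub_self, pow_zero, Nat.card_eq_one_iff_unique]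
    refine ⟨⟨fun a b => ?_⟩, ⟨1⟩⟩
    have key : ∀ a : rootsOfUnity p (𝓞 E), a = 1 := by
      rintro ⟨a, ha⟩
      by_contra hne
      refine h ⟨((a : 𝓞 E) : E), ?_⟩
      have h1 : ((a : 𝓞 E) : E) ^ p = 1 := by
        have := congrArg (fun u : (𝓞 E)ˣ => ((u : 𝓞 E) : E)) ((mem_rootsOfUnity _ _).1 ha)
        simpa using this
      have : Fact p.Prime := ⟨hp⟩
      rw [← orderOf_eq_prime h1]
      · exact IsPrimitiveRoot.orderOf _
      · intro h2
        apply hne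
        ext
        simpa using h2
    rw [key a, key b]

/-- A unit `u` of `K` has norm `u ^ p`, so the index divides `[U_K : U_K ^ p]`, whose exponent is
the unit rank plus one more if `K` contains the `p`-th roots of unity; that is `m - 1`. -/
theorem exists_index_unitNorms_eq_pow {p : ℕ} (hp : p.Prime) (hN : Module.finrank K N = p) :
    ∃ U, (unitNorms K N).index = p ^ U ∧ U + 1 ≤ cohMax p K := by
  have hle : (powMonoidHom p : (𝓞 K)ˣ →* (𝓞 K)ˣ).range ≤ unitNorms K N := by
    rintro _ ⟨u, rfl⟩
    refine ⟨unitExt K N u, ?_⟩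
    apply unitIncl_injective K
    ext
    change Algebra.norm K (algebraMap K N ((u : 𝓞 K) : K)) = _
    rw [Algebra.norm_algebraMap, hN]
    rfl
  have hidx : (powMonoidHom p : (𝓞 K)ˣ →* (𝓞 K)ˣ).range.index =
      p ^ (Units.rank K + (1 - theta p K)) := by
    rw [pow_add, ← card_ker_nsmul_units hp, ← Units.finrank_eq K]
    exact (card_ker_mul_index_range_nsmul (M := Additive (𝓞 K)ˣ) hp.ne_zero).2
  have hdvd := Subgroup.index_dvd_of_le hle
  rw [hidx] at hdvd
  obtain ⟨U, hU, h⟩ := (Nat.dvd_prime_pow hp).1 hdvd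
  refine ⟨U, h, ?_⟩
  have hK0 : 0 < Fintype.card (InfinitePlace K) := Fintype.card_pos
  have hrK : Units.rank K + 1 = Fintype.card (InfinitePlace K) := by
    rw [Units.rank]; omega
  rw [InfinitePlace.card_eq_nrRealPlaces_add_nrComplexPlaces] at hrK
  rw [cohMax]
  have : theta p K ≤ 1 := by
    rw [theta]; split_ifs <;> simp
  omega

end UnitGroups

section ElementaryAbelian

theorem HasFpDim.card {p : ℕ} {G : Type*} [Group G] {d : ℕ} (h : HasFpDim p G d) :
    Nat.card G = p ^ d := by
  obtain ⟨e⟩ := h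
  rw [Nat.card_congr e.toEquiv, Nat.card_congr Multiplicative.toAdd, Nat.card_fun, Nat.card_zmod,
    Nat.card_fin]

theorem exists_addEquiv_fin_zmod {p : ℕ} [Fact p.Prime] (A : Type*) [AddCommGroup A] [Finite A]
    [Module (ZMod p) A] : ∃ d, Nonempty (A ≃+ (Fin d → ZMod p)) :=
  ⟨_, ⟨(Module.finBasis (ZMod p) A).equivFun.toAddEquiv⟩⟩

theorem exists_hasFpDim {p : ℕ} (hp : p.Prime) (G : Type*) [CommGroup G] (hG : Nat.card G ≠ 0)
    (h : ∀ g : G, g ^ p = 1) : ∃ d, HasFpDim p G d := by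
  have : Fact p.Prime := ⟨hp⟩
  have : Finite G := Nat.finite_of_card_ne_zero hG
  let _ : Module (ZMod p) (Additive G) := AddCommGroup.zmodModule (G := Additive G) h
  obtain ⟨d, ⟨e⟩⟩ := exists_addEquiv_fin_zmod (p := p) (Additive G)
  exact ⟨d, ⟨AddEquiv.toMultiplicativeRight e⟩⟩

end ElementaryAbelian

/-! ### Ideal classes and capitulation -/

section ClassGroups

variable {K N : Type*} [Field K] [NumberField K] [Field N] [NumberField N] [Algebra K N]

theorem ker_classGroupMk (E : Type*) [Field E] [NumberField E] :
    (ClassGroup.mk (R := 𝓞 E) E).ker = principal E := by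
  ext I
  rw [MonoidHom.mem_ker, ← (ClassGroup.equiv E).injective.eq_iff, map_one, ClassGroup.equiv_mk,
    QuotientGroup.mk'_apply, QuotientGroup.eq_one_iff]
  have : Units.mapEquiv (↑(FractionalIdeal.canonicalEquiv (𝓞 E)⁰ E E) :
      FractionalIdeal (𝓞 E)⁰ E ≃* FractionalIdeal (𝓞 E)⁰ E) I = I := by
    ext1
    simp
  rw [this]
  rfl

theorem classGroupMk_surjective (E : Type*) [Field E] [NumberField E] :
    Function.Surjective (ClassGroup.mk (R := 𝓞 E) E) := by
  intro c
  obtain ⟨I, rfl⟩ := ClassGroup.mk0_surjective c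
  exact ⟨_, ClassGroup.mk_mk0 E I⟩

theorem extendedHom_classGroupMk (A : IdealGroup K) :
    ClassGroup.extendedHom (𝓞 K) (𝓞 N) (ClassGroup.mk K A) = ClassGroup.mk N (extend K N A) := by
  have : (ClassGroup.extendedHom (𝓞 K) (𝓞 N)).comp (ClassGroup.mk K) =
      (ClassGroup.mk N).comp (extend K N) := by
    refine hom_ext_of_primes fun v => ?_
    rw [MonoidHom.comp_apply, MonoidHom.comp_apply, extend_ofIdeal]
    have h := ClassGroup.mk_mk0 K (⟨v.asIdeal, mem_nonZeroDivisors_of_ne_zero v.ne_bot⟩ :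
      (Ideal (𝓞 K))⁰)
    have h' := ClassGroup.mk_mk0 N (⟨v.asIdeal.map (algebraMap (𝓞 K) (𝓞 N)),
      mem_nonZeroDivisors_of_ne_zero (Ideal.map_ne_bot_of_ne_bot v.ne_bot)⟩ : (Ideal (𝓞 N))⁰)
    exact (congrArg _ h).trans ((ClassGroup.extendedHom_mk0 _ _ _).trans h'.symm)
  exact DFunLike.congr_fun this A

theorem comap_extend_principal :
    (principal N).comap (extend K N) = (capitulationKernel K N).comap (ClassGroup.mk K) := by
  ext A
  rw [Subgroup.mem_comap, Subgroup.mem_comap, capitulationKernel, MonoidHom.mem_ker,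
    extendedHom_classGroupMk, ← MonoidHom.mem_ker, ker_classGroupMk]

variable (K N) in
-- The classes that capitulate are represented by the ideals of `K` that become principal in `N`;
-- inside `I_N` they form `(P_N ∩ I_K) / P_K`.
theorem card_capitulationKernel :
    Nat.card (capitulationKernel K N) =
      (basePrincipal K N).relIndex (principal N ⊓ baseIdeals K N) := by
  rw [inf_comm, baseIdeals, ← Subgroup.map_comap_eq, basePrincipal,
    Subgroup.relIndex_map_map_of_injective _ _ extend_injective, ← ker_classGroupMk,
    Subgroup.relIndex_ker, comap_extend_principal,
    Subgroup.map_comap_eq_self_of_surjective (classGroupMk_surjective K)]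

/-- If `𝔞 𝓞_N` is principal, so is its norm `𝔞 ^ [N : K]`. -/
theorem pow_finrank_of_mem_capitulationKernel {c : ClassGroup (𝓞 K)}
    (hc : c ∈ capitulationKernel K N) : c ^ Module.finrank K N = 1 := by
  obtain ⟨A, rfl⟩ := classGroupMk_surjective K c
  rw [← Subgroup.mem_comap, ← comap_extend_principal] at hc
  obtain ⟨x, hx⟩ := hc
  rw [← map_pow, ← MonoidHom.mem_ker, ker_classGroupMk, ← relNorm_extend (E := N), ← hx,
    relNorm_toPrincipalIdeal]
  exact ⟨_, rfl⟩

theorem principal_rat : principal ℚ = ⊤ := by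
  rw [← ker_classGroupMk, eq_top_iff]
  intro A _
  have : Fintype.card (ClassGroup (𝓞 ℚ)) = 1 := Rat.classNumber_eq
  have := Fintype.card_le_one_iff_subsingleton.1 this.le
  exact Subsingleton.elim _ _

theorem basePrincipal_rat (L : Type*) [Field L] [NumberField L] :
    basePrincipal ℚ L = baseIdeals ℚ L := by
  rw [basePrincipal, principal_rat, baseIdeals, MonoidHom.range_eq_map]

end ClassGroups

section Ambiguous

variable {F E : Type*} [Field F] [NumberField F] [Field E] [NumberField E] [Algebra F E]

theorem baseIdeals_le_ambiguous (p : ℕ) : baseIdeals F E ≤ ambiguous p F E :=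
  fun _ hA => (baseIdeals F E).pow_mem hA p

theorem ambiguousPrincipal_inf_baseIdeals (p : ℕ) :
    ambiguousPrincipal p F E ⊓ baseIdeals F E = principal E ⊓ baseIdeals F E := by
  rw [ambiguousPrincipal, inf_comm (ambiguous p F E), inf_assoc,
    inf_eq_right.2 (baseIdeals_le_ambiguous p)]

theorem basePrincipal_le (p : ℕ) :
    basePrincipal F E ≤ ambiguousPrincipal p F E ⊓ baseIdeals F E := by
  rw [ambiguousPrincipal_inf_baseIdeals]
  rintro _ ⟨_, ⟨x, rfl⟩, rfl⟩
  exact ⟨⟨_, (extend_toPrincipalIdeal x).symm⟩, ⟨_, rfl⟩⟩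

variable (F E) in
theorem card_capitulationKernel_mul_relIndex (p : ℕ) :
    Nat.card (capitulationKernel F E) * (baseIdeals F E).relIndex (ambiguousPrincipal p F E) =
      (basePrincipal F E).relIndex (ambiguousPrincipal p F E) := by
  rw [card_capitulationKernel, ← ambiguousPrincipal_inf_baseIdeals p,
    ← Subgroup.relIndex_mul_relIndex _ _ _ (basePrincipal_le p) inf_le_left,
    Subgroup.inf_relIndex_left]

end Ambiguous

/-! ### The norm to `L` and the three-step filtration of `P_{N/K} / P_K` -/

section Square

variable {F K L N : Type*} [Field F] [NumberField F] [Field K] [NumberField K]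
    [Field L] [NumberField L] [Field N] [NumberField N] [Algebra F K] [Algebra F L]
    [Algebra K N] [Algebra L N]

theorem extend_extend {F K N : Type*} [Field F] [NumberField F] [Field K] [NumberField K] [Field N]
    [NumberField N] [Algebra F K] [Algebra F N] [Algebra K N] [IsScalarTower F K N] (A : IdealGroup F) :
    extend K N (extend F K A) = extend F N A := by
  obtain ⟨h, h0, a, ha⟩ := exists_pow_eq_toPrincipalIdeal A
  apply pow_left_injective h0
  rw [← map_pow, ← map_pow, ← map_pow, ha, extend_toPrincipalIdeal, extend_toPrincipalIdeal,
    extend_toPrincipalIdeal]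
  congr 1
  ext
  exact (IsScalarTower.algebraMap_apply F K N _).symm

theorem relNorm_extend_comm (hnorm : ∀ x : K,
    Algebra.norm L (algebraMap K N x) = algebraMap F L (Algebra.norm F x)) (A : IdealGroup K) :
    relNorm L N (extend K N A) = extend F L (relNorm F K A) := by
  obtain ⟨h, h0, a, ha⟩ := exists_pow_eq_toPrincipalIdeal A
  apply pow_left_injective h0
  rw [← map_pow, ← map_pow, ← map_pow, ← map_pow, ha, extend_toPrincipalIdeal,
    relNorm_toPrincipalIdeal, relNorm_toPrincipalIdeal, extend_toPrincipalIdeal]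
  congr 1
  ext
  exact hnorm _

variable (hcomm : ∀ A : IdealGroup K, relNorm L N (extend K N A) = extend F L (relNorm F K A))

include hcomm

theorem baseIdeals_le_comap_relNorm :
    baseIdeals K N ≤ (baseIdeals F L).comap (relNorm L N) := by
  rintro _ ⟨A, rfl⟩
  exact ⟨_, (hcomm A).symm⟩

/-- The condition that the norm lies in `I_F` is constant on classes modulo `I_K`, so a class in the
intersection has one representative in `P_{N/K}` that satisfies it. -/
theorem relativeFactors_eq_map (p : ℕ) : relativeFactors p F K L N =
    ((baseIdeals F L).comap (relNorm L N) ⊓ ambiguousPrincipal p K N).map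
      (QuotientGroup.mk' (baseIdeals K N)) := by
  apply le_antisymm
  · rintro _ ⟨⟨a, ⟨-, ha⟩, rfl⟩, ⟨b, hb, hab⟩⟩
    obtain ⟨c, hc, d, hd, rfl⟩ := Subgroup.mem_sup.1 hb
    have hcd : QuotientGroup.mk' (baseIdeals K N) (c * d) =
        QuotientGroup.mk' (baseIdeals K N) c :=
      (QuotientGroup.eq.2 (by rwa [inv_mul_cancel_left])).symm
    rw [hcd] at hab
    refine ⟨c, ⟨?_, hc⟩, hab⟩
    have h := baseIdeals_le_comap_relNorm hcomm (QuotientGroup.eq.1 hab)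
    exact (Subgroup.inv_mem_iff _).1 ((Subgroup.mul_mem_cancel_right _ ha).1 h)
  · rintro _ ⟨c, ⟨hc, hc'⟩, rfl⟩
    exact ⟨⟨c, ⟨hc'.1, hc⟩, rfl⟩, ⟨c, Subgroup.mem_sup_left hc', rfl⟩⟩

theorem card_relativeFactors (p : ℕ) : Nat.card (relativeFactors p F K L N) =
    (baseIdeals K N).relIndex
      ((baseIdeals F L).comap (relNorm L N) ⊓ ambiguousPrincipal p K N) := by
  rw [relativeFactors_eq_map hcomm, ← Subgroup.relIndex_ker, QuotientGroup.ker_mk']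

theorem relIndex_baseIdeals_ambiguousPrincipal (p : ℕ) :
    (baseIdeals K N).relIndex (ambiguousPrincipal p K N) = Nat.card (relativeFactors p F K L N) *
      (baseIdeals F L).relIndex ((ambiguousPrincipal p K N).map (relNorm L N)) := by
  rw [card_relativeFactors hcomm, ← Subgroup.relIndex_comap, Subgroup.relIndex_inf_mul_relIndex,
    inf_eq_left.2 (baseIdeals_le_comap_relNorm hcomm)]

variable [Algebra F N] [IsScalarTower F K N] [IsScalarTower F L N]

/-- For `A` in `P_{L/F}`, the power `A ^ [N : L]` is the norm of `A 𝓞_N`, and `A ^ p` lies in `I_F`.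
A Bézout relation between the two exponents recovers `A`. -/
theorem map_relNorm_sup_baseIdeals {p : ℕ} (hLN : (Module.finrank L N).Coprime p) :
    (ambiguousPrincipal p K N).map (relNorm L N) ⊔ baseIdeals F L =
      ambiguousPrincipal p F L ⊔ baseIdeals F L := by
  apply le_antisymm
  · refine sup_le_sup_right ?_ _
    rintro _ ⟨A, ⟨⟨b, hb⟩, ⟨x, rfl⟩⟩, rfl⟩
    refine ⟨⟨relNorm F K b, ?_⟩, ⟨_, (relNorm_toPrincipalIdeal x).symm⟩⟩
    rw [← hcomm, hb]
    exact map_pow _ _ _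
  · refine sup_le ?_ le_sup_right
    rintro A ⟨⟨c, hc⟩, ⟨x, rfl⟩⟩
    set A := toPrincipalIdeal (𝓞 L) L x
    set H := (ambiguousPrincipal p K N).map (relNorm L N) ⊔ baseIdeals F L
    have h1 : A ^ Module.finrank L N ∈ H := by
      refine Subgroup.mem_sup_left ⟨extend L N A, ⟨⟨extend F K c, ?_⟩, ⟨_,
        (extend_toPrincipalIdeal x).symm⟩⟩, relNorm_extend A⟩
      rw [extend_extend, ← extend_extend (K := L), hc]
      exact map_pow _ _ _
    have h2 : A ^ p ∈ H := Subgroup.mem_sup_right ⟨c, hc⟩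
    have h3 : A = (A ^ Module.finrank L N) ^ (Module.finrank L N).gcdA p *
        (A ^ p) ^ (Module.finrank L N).gcdB p := by
      rw [← zpow_natCast, ← zpow_natCast, ← zpow_mul, ← zpow_mul, ← zpow_add,
        ← Nat.gcd_eq_gcd_ab, hLN]
      simp
    rw [h3]
    exact H.mul_mem (H.zpow_mem h1 _) (H.zpow_mem h2 _)

/-- The decomposition of `P_{N/K} / P_K` into capitulation kernel, relative principal factors, and
the part coming from `L`. -/
theorem relIndex_basePrincipal_eq_card_mul {p : ℕ} (hLN : (Module.finrank L N).Coprime p) :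
    (basePrincipal K N).relIndex (ambiguousPrincipal p K N) =
      (baseIdeals F L).relIndex (ambiguousPrincipal p F L) *
        Nat.card (relativeFactors p F K L N) * Nat.card (capitulationKernel K N) := by
  rw [← card_capitulationKernel_mul_relIndex, relIndex_baseIdeals_ambiguousPrincipal hcomm,
    ← Subgroup.relIndex_sup_right (ambiguousPrincipal p F L), ← map_relNorm_sup_baseIdeals hcomm hLN,
    Subgroup.relIndex_sup_right]
  ring

end Square

section ClassRank

variable {K : Type*} [Field K] [NumberField K]

/-- In a finite abelian group the kernel and the cokernel of the `p`-th power map have the same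
order. -/
theorem pow_classRank {p : ℕ} (hp : p.Prime) :
    p ^ classRank p K = Nat.card (powMonoidHom p : ClassGroup (𝓞 K) →* ClassGroup (𝓞 K)).ker := by
  have : Fact p.Prime := ⟨hp⟩
  have hfin : Finite (ModN (Additive (ClassGroup (𝓞 K))) p) := Quotient.finite _
  have h1 := Module.natCard_eq_pow_finrank (K := ZMod p)
    (V := ModN (Additive (ClassGroup (𝓞 K))) p)
  rw [Nat.card_zmod] at h1
  rw [classRank, ← h1]
  have h2 : Nat.card (LinearMap.range (LinearMap.lsmul ℤ (Additive (ClassGroup (𝓞 K))) p)) =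
      Nat.card (powMonoidHom p : ClassGroup (𝓞 K) →* ClassGroup (𝓞 K)).range :=
    Nat.card_congr (Equiv.subtypeEquiv Additive.toMul fun a =>
      exists_congr fun b => by
        rw [← Additive.toMul.injective.eq_iff, LinearMap.lsmul_apply, natCast_zsmul]
        rfl)
  have h3 := Submodule.card_eq_card_quotient_mul_card
    (LinearMap.range (LinearMap.lsmul ℤ (Additive (ClassGroup (𝓞 K))) p))
  have h4 := (powMonoidHom p : ClassGroup (𝓞 K) →* ClassGroup (𝓞 K)).ker.card_mul_index
  rw [Subgroup.index_ker, ← h2] at h4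
  rw [mul_comm] at h4
  exact Nat.eq_of_mul_eq_mul_left Nat.card_pos (h3.symm.trans h4.symm)

theorem card_capitulationKernel_le {N : Type*} [Field N] [NumberField N] [Algebra K N] {p : ℕ}
    (hp : p.Prime) (hN : Module.finrank K N = p) :
    Nat.card (capitulationKernel K N) ≤ p ^ classRank p K := by
  rw [pow_classRank hp]
  refine Subgroup.card_le_of_le fun c hc => ?_
  rw [MonoidHom.mem_ker, powMonoidHom_apply, ← hN]
  exact pow_finrank_of_mem_capitulationKernel hc

end ClassRank

/-! ### The value of `m` for quadratic fields -/

section Quadratic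

open NumberField

variable {K : Type*} [Field K] [NumberField K] {p : ℕ}

theorem theta_of_isTotallyReal [IsTotallyReal K] (hp : p.Prime) (hp2 : p ≠ 2) : theta p K = 1 := by
  rw [theta, if_neg]
  rintro ⟨ζ, hζ⟩
  obtain ⟨φ⟩ : Nonempty (K →+* ℂ) := inferInstance
  let ψ := (IsTotallyReal.complexEmbedding_isReal φ).embedding
  have h1 : IsPrimitiveRoot (ψ ζ) p := hζ.map_of_injective ψ.injective
  have h2 : ψ ζ = 1 := (hp.odd_of_ne_two hp2).strictMono_pow.injective (by
    simpa using h1.pow_eq_one)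
  exact h1.ne_one hp.one_lt h2

theorem eq_three_of_isPrimitiveRoot (h2 : Module.finrank ℚ K = 2) (hp : p.Prime) (hp2 : p ≠ 2)
    {ζ : K} (hζ : IsPrimitiveRoot ζ p) : p = 3 := by
  have h := hζ.lcm_totient_le_finrank hζ
    (Polynomial.cyclotomic.irreducible_rat (Nat.lcm_pos hp.pos hp.pos))
  rw [Nat.lcm_self, Nat.totient_prime hp, h2] at h
  have := hp.two_le
  omega

omit [NumberField K] in
theorem add_add_one_eq_zero_of_isPrimitiveRoot {ζ : K} (hζ : IsPrimitiveRoot ζ 3) :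
    ζ ^ 2 + ζ + 1 = 0 := by
  have h1 : (ζ - 1) * (ζ ^ 2 + ζ + 1) = 0 := by
    linear_combination hζ.pow_eq_one
  exact (mul_eq_zero.1 h1).resolve_left (sub_ne_zero.2 (hζ.ne_one (by norm_num)))

theorem isPrimitiveRoot_three_of_sq_eq {x : K} (hx : x ^ 2 = -3) :
    IsPrimitiveRoot ((x - 1) / 2) 3 := by
  refine IsPrimitiveRoot.of_map_of_injective (f := RingHom.id K) ?_ Function.injective_id
  rw [RingHom.id_apply]
  have h3 : ((x - 1) / 2) ^ 3 = 1 := by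
    linear_combination (x - 3) / 8 * hx
  have : Fact (Nat.Prime 3) := ⟨Nat.prime_three⟩
  have h := orderOf_eq_prime h3 (fun h => ?_)
  · conv_rhs => rw [← h]
    exact IsPrimitiveRoot.orderOf _
  · have hx3 : x = 3 := by linear_combination 2 * h
    rw [hx3] at hx
    norm_num at hx

theorem cohMax_of_isTotallyReal [IsTotallyReal K] (h2 : Module.finrank ℚ K = 2) (hp : p.Prime)
    (hp2 : p ≠ 2) : cohMax p K = 2 := by
  rw [cohMax, theta_of_isTotallyReal hp hp2, IsTotallyReal.nrComplexPlaces_eq_zero,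
    ← IsTotallyReal.finrank, h2]

theorem cohMax_three_of_sq_eq (h2 : Module.finrank ℚ K = 2) {x : K} (hx : x ^ 2 = -3) :
    cohMax 3 K = 2 := by
  have hθ : theta 3 K = 0 := if_pos ⟨_, isPrimitiveRoot_three_of_sq_eq hx⟩
  have h := InfinitePlace.card_add_two_mul_card_eq_rank K
  have h0 : InfinitePlace.nrComplexPlaces K ≠ 0 := by
    intro h0
    have := nrComplexPlaces_eq_zero_iff.1 h0
    rw [theta_of_isTotallyReal Nat.prime_three (by norm_num)] at hθ
    omega
  rw [cohMax, hθ]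
  omega

theorem cohMax_of_isTotallyComplex [IsTotallyComplex K] (h2 : Module.finrank ℚ K = 2)
    (hp : p.Prime) (hp2 : p ≠ 2) (hK : ¬ (p = 3 ∧ ∃ x : K, x ^ 2 = -3)) : cohMax p K = 1 := by
  have hθ : theta p K = 1 := by
    rw [theta, if_neg]
    rintro ⟨ζ, hζ⟩
    obtain rfl := eq_three_of_isPrimitiveRoot h2 hp hp2 hζ
    exact hK ⟨rfl, 2 * ζ + 1, by
      linear_combination 4 * add_add_one_eq_zero_of_isPrimitiveRoot hζ⟩
  have h := IsTotallyComplex.finrank K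
  rw [cohMax, hθ, IsTotallyComplex.nrRealPlaces_eq_zero]
  omega

end Quadratic

/-! ### Bounds by totally ramified primes -/

section Estimates

open IsDedekindDomain

theorem ncard_primes {E : Type*} [Field E] [NumberField E] {P : Ideal (𝓞 E) → Prop}
    (hP : ∀ I, P I → I.IsPrime ∧ I ≠ ⊥) :
    {I | P I}.ncard = {w : HeightOneSpectrum (𝓞 E) | P w.asIdeal}.ncard := by
  rw [← Set.ncard_image_of_injective (f := HeightOneSpectrum.asIdeal) _
    (fun _ _ h => HeightOneSpectrum.ext h)]
  congr 1
  ext I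
  exact ⟨fun h => ⟨⟨I, (hP I h).1, (hP I h).2⟩, h, rfl⟩, by rintro ⟨w, h, rfl⟩; exact h⟩

variable {F K L N : Type*} [Field F] [NumberField F] [Field K] [NumberField K]
    [Field L] [NumberField L] [Field N] [NumberField N] [Algebra F K] [Algebra F L] [Algebra F N]
    [Algebra K N] [Algebra L N] [IsScalarTower F K N] [IsScalarTower F L N] {p : ℕ}

omit [Algebra F N] [IsScalarTower F L N] in
theorem nonsplitCount_add_splitCount (hL : 1 < Module.finrank F L) :
    nonsplitCount F L N + splitCount F L N =
      {w : HeightOneSpectrum (𝓞 L) | TotallyRamified F w.asIdeal}.ncard := by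
  rw [nonsplitCount, splitCount, ncard_primes fun I h => ⟨h.1.1, h.1.2.1⟩,
    ncard_primes fun I h => ⟨h.1.1, h.1.2.1⟩, ← Set.ncard_union_eq (Set.disjoint_left.2 fun w h h' => h.2 h'.2)
      ((finite_totallyRamified hL).subset fun w h => h.1)
      ((finite_totallyRamified hL).subset fun w h => h.1)]
  congr 1
  ext w
  simp only [Set.mem_union, Set.mem_ofPred_eq]
  tauto

omit [Algebra F N] [IsScalarTower F L N] in
theorem relIndex_baseIdeals_ambiguousPrincipal_le (hp : p.Prime) (hL : Module.finrank F L = p) :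
    (baseIdeals F L).relIndex (ambiguousPrincipal p F L) ≤
      p ^ (nonsplitCount F L N + splitCount F L N) := by
  have h1 : 1 < Module.finrank F L := hL ▸ hp.one_lt
  rw [nonsplitCount_add_splitCount h1]
  exact relIndex_le_of_val hp (finite_totallyRamified h1) fun A hA h =>
    mem_baseIdeals_of_dvd_val hp hL hA.1 h

/-- Ramification indices multiply along both towers. The one of `N/L` is at most `2 < p`, so the
factor `p` coming from `N/K` must occur in `L/F`. -/
theorem totallyRamified_under (hp : p.Prime) (hp2 : p ≠ 2) (hL : Module.finrank F L = p)
    (hKN : Module.finrank K N = p) (hLN : Module.finrank L N = 2) (w : HeightOneSpectrum (𝓞 N))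
    (hw : TotallyRamified K w.asIdeal) : TotallyRamified F (w.under (𝓞 L)).asIdeal := by
  have := w.isPrime
  have : w.asIdeal.LiesOver (w.under (𝓞 L)).asIdeal := ⟨rfl⟩
  have : w.asIdeal.LiesOver (w.under (𝓞 K)).asIdeal := ⟨rfl⟩
  apply totallyRamified_of_ramificationIdx_eq
  have h1 := Ideal.ramificationIdx_tower (R := 𝓞 F) (w.under (𝓞 L)).asIdeal w.asIdeal
  have h2 := Ideal.ramificationIdx_tower (R := 𝓞 F) (w.under (𝓞 K)).asIdeal w.asIdeal
  rw [ramificationIdx_eq_of_totallyRamified w hw, hKN] at h2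
  have h3 : ¬ p ∣ w.asIdeal.ramificationIdx (𝓞 L) := by
    intro h
    have h4 := Nat.le_of_dvd (Ideal.ramificationIdx_pos _ _) h
    have h5 := ramificationIdx_le (F := L) w
    have := hp.two_le
    omega
  have h4 : p ∣ (w.under (𝓞 L)).asIdeal.ramificationIdx (𝓞 F) :=
    (hp.dvd_mul.1 (h1 ▸ h2 ▸ dvd_mul_left p _)).resolve_right h3
  have := (w.under (𝓞 L)).isPrime
  exact le_antisymm (ramificationIdx_le _)
    (hL ▸ Nat.le_of_dvd (Ideal.ramificationIdx_pos _ _) h4)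

/-- One chosen prime of `N` above each split totally ramified prime of `L` suffices. For `A` with
norm in `I_F`, the norm has valuation divisible by `p` at every totally ramified prime of `L`. Above
an undecomposed one this valuation is `f · w(A)` with `f ≤ 2 < p`, so `p ∣ w(A)`; above a split one
it is the sum of two valuations, so either of them controls the other. -/
theorem card_relativeFactors_le
    (hcomm : ∀ A : IdealGroup K, relNorm L N (extend K N A) = extend F L (relNorm F K A))
    (hp : p.Prime) (hp2 : p ≠ 2) (hL : Module.finrank F L = p)
    (hKN : Module.finrank K N = p) (hLN : Module.finrank L N = 2) :
    Nat.card (relativeFactors p F K L N) ≤ p ^ splitCount F L N := by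
  classical
  rw [card_relativeFactors hcomm]
  have hex : ∀ v : HeightOneSpectrum (𝓞 L), ∃ w : HeightOneSpectrum (𝓞 N),
      w.under (𝓞 L) = v := by
    intro v
    rcases primes_over_of_finrank_eq_two hLN v with ⟨w, hw, -⟩ | ⟨-, w, w', -, hw, -⟩
    · exact ⟨w, (hw w).2 rfl⟩
    · exact ⟨w, (hw w).2 (Or.inl rfl)⟩
  choose c hc using hex
  have hT : {v : HeightOneSpectrum (𝓞 L) | TotallyRamified F v.asIdeal ∧
      SplitsIn N v.asIdeal}.Finite :=
    (finite_totallyRamified (hL ▸ hp.one_lt)).subset fun w h => h.1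
  rw [splitCount, ncard_primes fun I h => ⟨h.1.1, h.1.2.1⟩]
  refine (relIndex_le_of_val hp (hT.image c) fun A hA h => ?_).trans
    (Nat.pow_le_pow_right hp.pos (Set.ncard_image_le hT))
  refine mem_baseIdeals_of_dvd_val hp hKN hA.2.1 fun w hw => ?_
  have hv := totallyRamified_under hp hp2 hL hKN hLN w hw
  have hdvd := dvd_val_of_mem_baseIdeals hA.1 _ hv
  rw [hL] at hdvd
  have := w.isPrime
  rcases primes_over_of_finrank_eq_two hLN (w.under (𝓞 L)) with ⟨u, hu, hf⟩ |
    ⟨hsplit, u, u', hne, hu, hf, hf'⟩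
  · obtain rfl := (hu w).1 rfl
    rw [val_relNorm _ {w} (by simpa using fun x => (hu x).symm), Finset.prod_singleton,
      toAdd_pow, nsmul_eq_mul] at hdvd
    refine (Int.Prime.dvd_mul' hp hdvd).resolve_left fun h' => ?_
    have h4 := Nat.le_of_dvd (Ideal.inertiaDeg_pos w.asIdeal (𝓞 L)) (Int.natCast_dvd_natCast.1 h')
    have := hp.two_le
    omega
  · rw [val_relNorm _ {u, u'} (by simpa using fun x => (hu x).symm), Finset.prod_pair hne, hf, hf',
      pow_one, pow_one, toAdd_mul] at hdvd
    have hcv := h _ ⟨_, ⟨hv, hsplit⟩, rfl⟩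
    have key : (p : ℤ) ∣ (val u A).toAdd ∧ (p : ℤ) ∣ (val u' A).toAdd := by
      rcases (hu _).1 (hc (w.under (𝓞 L))) with h' | h' <;> rw [h'] at hcv
      · exact ⟨hcv, (dvd_add_right hcv).1 hdvd⟩
      · exact ⟨(dvd_add_left hcv).1 hdvd, hcv⟩
    rcases (hu w).1 rfl with h' | h' <;> rw [h']
    · exact key.1
    · exact key.2

end Estimates

/-! ### Degrees and linear disjointness in the compositum -/

section Degrees

variable {N : Type*} [Field N] [NumberField N] {K L : IntermediateField ℚ N} {p : ℕ}

theorem finrank_eq_of_compositum (hp : p.Prime) (hNK : Module.finrank K N = p)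
    (hL : Module.finrank ℚ L = p) : Module.finrank ℚ K = Module.finrank L N := by
  have h1 := Module.finrank_mul_finrank ℚ K N
  have h2 := Module.finrank_mul_finrank ℚ L N
  rw [hNK] at h1
  rw [hL, ← h1, mul_comm] at h2
  exact (Nat.eq_of_mul_eq_mul_right hp.pos h2).symm

/-- Coprime degrees make `L` and `K` linearly disjoint over `ℚ`, so elements of `K` have the same
norm in `N/L` as in `K/ℚ`. -/
theorem relNorm_extend_comm_of_compositum (hp : p.Prime) (hNK : Module.finrank K N = p)
    (hL : Module.finrank ℚ L = p) (hNL : (Module.finrank L N).Coprime p) (hcomp : L ⊔ K = ⊤)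
    (A : IdealGroup K) : relNorm L N (extend K N A) = extend ℚ L (relNorm ℚ K A) := by
  have hd : L.LinearDisjoint K := by
    apply IntermediateField.LinearDisjoint.of_finrank_coprime
    rw [hL, finrank_eq_of_compositum hp hNK hL]
    exact hNL.symm
  exact relNorm_extend_comm (fun x => hd.norm_algebraMap hcomp x) A

end Degrees

section Torsion

variable {F K L N : Type*} [Field F] [NumberField F] [Field K] [NumberField K]
    [Field L] [NumberField L] [Field N] [NumberField N] [Algebra F L]
    [Algebra K N] [Algebra L N]

theorem pow_eq_one_of_relativeFactors {p : ℕ} (g : relativeFactors p F K L N) : g ^ p = 1 := by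
  obtain ⟨_, ⟨⟨a, ha, rfl⟩, -⟩⟩ := g
  refine Subtype.ext ?_
  exact (QuotientGroup.eq_one_iff (a ^ p)).2 ha.1

theorem card_principalFactors (p : ℕ) (F E : Type*) [Field F] [NumberField F] [Field E]
    [NumberField E] [Algebra F E] : Nat.card (PrincipalFactors p F E) =
      (basePrincipal F E).relIndex (ambiguousPrincipal p F E) := rfl

/-- A `p`-th power is a priori only in `I_ℚ`; class number one puts it in `P_ℚ`. -/
theorem pow_eq_one_of_principalFactors_rat {p : ℕ} (g : PrincipalFactors p ℚ L) : g ^ p = 1 := by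
  obtain ⟨a, rfl⟩ := QuotientGroup.mk_surjective g
  refine (QuotientGroup.eq_one_iff (a ^ p)).2 ?_
  rw [Subgroup.mem_subgroupOf, basePrincipal_rat]
  exact a.2.1

end Torsion

end DPF

end

/-! ### The fundamental equation and estimates -/

theorem mainTheorem2 {N : Type*} [Field N] [NumberField N] (K L : IntermediateField ℚ N)
    (p : ℕ) (hp : p.Prime) (hp2 : p ≠ 2)
    (hgal : IsGalois K N) (hcyc : IsCyclic (N ≃ₐ[K] N))
    (hNK : Module.finrank K N = p)
    (hL : Module.finrank ℚ L = p)
    (hNL : (Module.finrank L N).Coprime p)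
    (hcomp : L ⊔ K = ⊤) :
    ∃ U A R C : ℕ,
      (DPF.unitNorms K N).index = p ^ U ∧
      DPF.HasFpDim p (DPF.PrincipalFactors p ℚ L) A ∧
      DPF.HasFpDim p (DPF.relativeFactors p ℚ K L N) R ∧
      DPF.HasFpDim p (DPF.capitulationKernel K N) C ∧
      U + 1 = A + R + C ∧
      U + 1 ≤ DPF.cohMax p K ∧
      (Module.finrank ℚ K = 2 →
        A ≤ min (DPF.nonsplitCount ℚ L N + DPF.splitCount ℚ L N) (DPF.cohMax p K) ∧
        R ≤ min (DPF.splitCount ℚ L N) (DPF.cohMax p K) ∧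
        C ≤ min (DPF.classRank p K) (DPF.cohMax p K) ∧
        (NumberField.IsTotallyReal K → DPF.cohMax p K = 2) ∧
        (p = 3 → (∃ x : K, x ^ 2 = -3) → DPF.cohMax p K = 2) ∧
        (NumberField.IsTotallyComplex K → ¬ (p = 3 ∧ ∃ x : K, x ^ 2 = -3) →
          DPF.cohMax p K = 1)) := by
  obtain ⟨σ, hσ⟩ := hcyc.exists_generator
  have hcomm := DPF.relNorm_extend_comm_of_compositum hp hNK hL hNL hcomp
  obtain ⟨U, hU, hUle⟩ := DPF.exists_index_unitNorms_eq_pow (K := K) hp hNK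
  have hmul := (DPF.relIndex_basePrincipal_eq_mul_index hσ hp hp2 hNK).2
  rw [DPF.relIndex_basePrincipal_eq_card_mul hcomm hNL, hU, ← DPF.basePrincipal_rat,
    ← DPF.card_principalFactors, ← pow_succ'] at hmul
  -- `Nat.card` of an infinite group is zero, so a nonzero product of the three orders shows that
  -- all three groups are finite.
  have h0 : p ^ (U + 1) ≠ 0 := pow_ne_zero _ hp.ne_zero
  rw [← hmul] at h0
  have hA0 := left_ne_zero_of_mul (left_ne_zero_of_mul h0)
  have hR0 := right_ne_zero_of_mul (left_ne_zero_of_mul h0)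
  have hC0 := right_ne_zero_of_mul h0
  obtain ⟨A, hA⟩ := DPF.exists_hasFpDim hp _ hA0 DPF.pow_eq_one_of_principalFactors_rat
  obtain ⟨R, hR⟩ := DPF.exists_hasFpDim hp _ hR0 DPF.pow_eq_one_of_relativeFactors
  obtain ⟨C, hC⟩ := DPF.exists_hasFpDim hp _ hC0 fun g => Subtype.ext
    (hNK ▸ DPF.pow_finrank_of_mem_capitulationKernel g.2)
  have hsum : U + 1 = A + R + C := by
    rw [hA.card, hR.card, hC.card, ← pow_add, ← pow_add] at hmul
    exact (Nat.pow_right_injective hp.two_le hmul).symm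
  refine ⟨U, A, R, C, hU, hA, hR, hC, hsum, hUle, fun hK => ⟨le_min ?_ (by omega),
    le_min ?_ (by omega), le_min ?_ (by omega), fun _ => DPF.cohMax_of_isTotallyReal hK hp hp2,
    ?_, fun _ h => DPF.cohMax_of_isTotallyComplex hK hp hp2 h⟩⟩
  · rw [← Nat.pow_le_pow_iff_right hp.one_lt, ← hA.card, DPF.card_principalFactors,
      DPF.basePrincipal_rat]
    exact DPF.relIndex_baseIdeals_ambiguousPrincipal_le hp hL
  · rw [← Nat.pow_le_pow_iff_right hp.one_lt, ← hR.card]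
    exact DPF.card_relativeFactors_le hcomm hp hp2 hL hNK
      ((DPF.finrank_eq_of_compositum hp hNK hL).symm.trans hK)
  · rw [← Nat.pow_le_pow_iff_right hp.one_lt, ← hC.card]
    exact DPF.card_capitulationKernel_le hp hNK
  · rintro rfl ⟨x, hx⟩
    exact DPF.cohMax_three_of_sq_eq hK hx
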